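/- Write $\mathbb{Z}_2=\mathbb{Z}/2\mathbb{Z}$ and $M_n=M_n(\mathbb{C})$. For $k\in\mathbb{N}=\{1,2,\dots\}$ let $r(k)=\frac12(3^k-1)$ and let $$w_k=\begin{pmatrix}0&1_{M_{r(k)}}&0\\ 1_{M_{r(k)}}&0&0\\ 0&0&1\end{pmatrix}\in M_{3^k}.$$ Let $B=\bigotimes_{k=1}^\infty M_{3^k}$ (the $3^\infty$ UHF algebra), and let $\gamma\colon\mathbb{Z}_2\to\operatorname{Aut}(B)$ be the action generated by the order two automorphism $\nu=\bigotimes_{k=1}^\infty\operatorname{Ad}(w_k)$. Let $G=\prod_{n=1}^\infty\mathbb{Z}_2$ with the product topology, $A=\bigotimes_{n=1}^\infty B$ (infinite minimal tensor product), and let $\alpha\colon G\to\operatorname{Aut}(A)$ be the infinite tensor product action, determined by $$\alpha_g(a_1\otimes\cdots\otimes a_n\otimes1)=\gamma_{g_1}(a_1)\otimes\cdots\otimes\gamma_{g_n}(a_n)\otimes1 .$$ Conventions. For a C*-algebra $D$ and $a,b\in D_+$, $a\precsim_D b$ means that there is a sequence $(v_n)$ in $D$ with $v_nbv_n^*\to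 a$. $A^\alpha$ is the fixed point algebra. $G$ acts on $C(G)$ by $\mathtt{Lt}_g(f)(h)=f(g^{-1}h)$. For a projection $p\in A^\alpha$, subsets $F\subseteq A$, $S\subseteq C(G)$ and $\varepsilon>0$, a unital completely positive map $\varphi\colon C(G)\to pAp$ is *$(F,S,\varepsilon)$-approximately equivariant central multiplicative* if $\|\varphi(fh)-\varphi(f)\varphi(h)\|<\varepsilon$ for $f,h\in S$, $\|\varphi(f)a-a\varphi(f)\|<\varepsilon$ for $f\in S$ and $a\in F$, and $\sup_{g\in G}\|\varphi(\mathtt{Lt}_g(f))-\alpha_g(\varphi(f))\|<\varepsilon$ for $f\in S$. A continuous action $\alpha$ of a second countable compact group $G$ on an infinite dimensional simple unital C*-algebra $A$ has the *tracial Rokhlin property with comparison* if for all finite $F\subseteq A$, $S\subseteq C(G)$, all $\varepsilon>0$, all $x\in A_+$ with $\|x\|=1$, and all $y\in(A^\alpha)_+\setminus\{0\}$ there are a projection $p\in A^\alpha$ and a unital completely positive map $\varphi\colon C(G)\to pAp$ such that 1. $\varphi$ is $(F,S,\varepsilon)$-approximately equivariant central multiplicative; 2. $1-p\precsim_A x$;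 3. $1-p\precsim_{A^\alpha}y$; 4. $1-p\precsim_{A^\alpha}p$; 5. $\|pxp\|>1-\varepsilon$. If $A$ is moreover separable, $\alpha$ has the *strong modified tracial Rokhlin property* if for all finite $F\subseteq A$, $S\subseteq C(G)$, all $\varepsilon>0$, and all $x\in A_+$ with $\|x\|=1$ there are a projection $p\in A^\alpha$, a partial isometry $s\in A^\alpha$, and a unital completely positive contractive map $\varphi\colon C(G)\to pAp$ such that (1), (2) and (5) hold, $s^*s=1-p$, $ss^*\le p$, and $\|sa-as\|<\varepsilon$ for all $a\in F$. **Theorem.** The action $\alpha\colon G\to\operatorname{Aut}(A)$ constructed above has the tracial Rokhlin property with comparison and the strong modified tracial Rokhlin property (in particular, $A$ is infinite dimensional, simple and separable, and $\alpha$ is continuous). Moreover, the same $p$ and $\varphi$ can be used for both: for all $F,S,\varepsilon,x,y$ as above there are $p$ and $\varphi$ satisfying (1)–(5) for which there is also $s$ such that $p,s,\varphi$ satisfy the conditions of the strong modified tracial Rokhlin property for $F,S,\varepsilon,x$. -/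

import Mathlib

noncomputable section
open scoped ENNReal
abbrev EllTwo (X : Type) : Type := lp (fun _ : X => ℂ) 2

abbrev Operators (X : Type) : Type := EllTwo X →L[ℂ] EllTwo X

namespace EllTwo

theorem memℓp_iff {X : Type} (f : X → ℂ) :
    Memℓp f 2 ↔ ∑' x, ‖f x‖ₑ ^ 2 ≠ ∞ := by
  rw [memℓp_gen_iff (by norm_num)]
  have h (x : X) : ‖f x‖ₑ ^ 2 = ENNReal.ofReal (‖f x‖ ^ 2) := by
    rw [ENNReal.ofReal_pow (norm_nonneg _), ofReal_norm]
  simp_rw [h]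
  constructor
  · intro hs
    refine Summable.tsum_ofReal_ne_top ?_
    simpa using hs
  · intro hs
    have := ENNReal.summable_toReal hs
    simpa [ENNReal.toReal_ofReal] using this

theorem tsum_enorm_sq {X : Type} (f : EllTwo X) : ∑' x, ‖f x‖ₑ ^ 2 = ‖f‖ₑ ^ 2 := by
  have h (x : X) : ‖f x‖ₑ ^ 2 = ENNReal.ofReal (‖f x‖ ^ 2) := by
    rw [ENNReal.ofReal_pow (norm_nonneg _), ofReal_norm]
  have hs : HasSum (fun x => ‖f x‖ ^ 2) (‖f‖ ^ 2) := by
    simpa using lp.hasSum_norm (p := 2) (by norm_num) f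
  simp_rw [h]
  rw [← ENNReal.ofReal_tsum_of_nonneg (fun _ => by positivity) hs.summable, hs.tsum_eq,
    ENNReal.ofReal_pow (norm_nonneg _), ofReal_norm]

/-- The permutation unitary of `σ` on `ℓ²(X)`: `(U_σ f)(x) = f(σ⁻¹ x)`, so `U_σ δ_x = δ_{σ x}`. -/
def permIsometry {X : Type} (σ : Equiv.Perm X) : EllTwo X ≃ₗᵢ[ℂ] EllTwo X where
  toFun f := ⟨fun x => f (σ.symm x), (memℓp_iff _).2 <| by
    rw [σ.symm.tsum_eq (fun x => ‖f x‖ₑ ^ 2)]; exact (memℓp_iff _).1 f.2⟩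
  invFun f := ⟨fun x => f (σ x), (memℓp_iff _).2 <| by
    rw [σ.tsum_eq (fun x => ‖f x‖ₑ ^ 2)]; exact (memℓp_iff _).1 f.2⟩
  map_add' f g := rfl
  map_smul' c f := rfl
  left_inv f := by ext x; simp
  right_inv f := by ext x; simp
  norm_map' f := by
    rw [← enorm_eq_iff_norm_eq, ← ENNReal.pow_right_strictMono (two_ne_zero) |>.injective.eq_iff]
    dsimp only
    rw [← tsum_enorm_sq, ← tsum_enorm_sq]
    exact σ.symm.tsum_eq (fun x => ‖f x‖ₑ ^ 2)

@[simp] theorem permIsometry_apply {X : Type} (σ : Equiv.Perm X) (f : EllTwo X) (x : X) :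
    permIsometry σ f x = f (σ.symm x) := rfl

/-- The automorphism `Ad U_σ` of the bounded operators on `ℓ²(X)`. -/
def permAd {X : Type} : Equiv.Perm X →* (Operators X ≃⋆ₐ[ℂ] Operators X) where
  toFun σ := (permIsometry σ).conjStarAlgEquiv
  map_one' := by
    ext T f x; rfl
  map_mul' σ τ := by
    ext T f x; rfl

@[simp] theorem permAd_apply {X : Type} (σ : Equiv.Perm X) (T : Operators X) (f : EllTwo X) (x : X) :
    permAd σ T f x = T ((permIsometry σ).symm f) (σ.symm x) := rfl
theorem continuous_permAd {X : Type} (σ : Equiv.Perm X) : Continuous (permAd σ) :=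
  (NonUnitalStarAlgHom.isometry (permAd σ) (permAd σ).injective).continuous

end EllTwo

/-- The restricted product of the pointed sets `(X n, x₀ n)`. -/
def RestrictedProd (X : ℕ → Type) (x₀ : ∀ n, X n) : Type :=
  {y : ∀ n, X n // {n | y n ≠ x₀ n}.Finite}

namespace RestrictedProd

variable {X : ℕ → Type} {x₀ : ∀ n, X n}

/-- The base point. -/
def base (x₀ : ∀ n, X n) : RestrictedProd X x₀ := ⟨x₀, by simp⟩

/-- Replace the `n`-th coordinate of `y` by `a`. -/
def update (n : ℕ) (y : RestrictedProd X x₀) (a : X n) : RestrictedProd X x₀ :=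
  ⟨Function.update y.1 n a, (y.2.insert n).subset fun m hm => by
    by_cases h : m = n
    · exact Or.inl h
    · refine Or.inr ?_
      simpa [Function.update_of_ne h] using hm⟩

@[simp] theorem update_val (n : ℕ) (y : RestrictedProd X x₀) (a : X n) :
    (update n y a).1 = Function.update y.1 n a := rfl

@[simp] theorem update_update (n : ℕ) (y : RestrictedProd X x₀) (a b : X n) :
    update n (update n y a) b = update n y b := Subtype.ext (by simp)

@[simp] theorem update_self (n : ℕ) (y : RestrictedProd X x₀) : update n y (y.1 n) = y :=
  Subtype.ext (by simp)

theorem update_injective (n : ℕ) (y : RestrictedProd X x₀) :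
    Function.Injective (update n y) := fun a b h => by
  have := congrArg (fun z : RestrictedProd X x₀ => z.1 n) h
  simpa using this

/-- Split off the `n`-th coordinate. -/
def splitEquiv (X : ℕ → Type) (x₀ : ∀ n, X n) (n : ℕ) :
    {z : RestrictedProd X x₀ // z.1 n = x₀ n} × X n ≃ RestrictedProd X x₀ where
  toFun q := update n q.1.1 q.2
  invFun y := (⟨update n y (x₀ n), by simp⟩, y.1 n)
  left_inv := by
    rintro ⟨⟨z, hz⟩, a⟩
    refine Prod.ext (Subtype.ext ?_) ?_
    · simp [← hz]
    · simp
  right_inv y := by simp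

/-- The product of base point preserving permutations of the factors. -/
def prodPerm (σ : ∀ n, Equiv.Perm (X n)) (hσ : ∀ n, σ n (x₀ n) = x₀ n) :
    Equiv.Perm (RestrictedProd X x₀) where
  toFun y := ⟨fun n => σ n (y.1 n), y.2.subset fun n hn h => hn (by simp only [h, hσ])⟩
  invFun y := ⟨fun n => (σ n).symm (y.1 n), y.2.subset fun n hn h => hn (by
    simp only [h, Equiv.symm_apply_eq, hσ])⟩
  left_inv y := Subtype.ext (by simp)
  right_inv y := Subtype.ext (by simp)

@[simp] theorem prodPerm_val (σ : ∀ n, Equiv.Perm (X n)) (hσ : ∀ n, σ n (x₀ n) = x₀ n)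
    (y : RestrictedProd X x₀) (n : ℕ) : (prodPerm σ hσ y).1 n = σ n (y.1 n) := rfl

@[simp] theorem prodPerm_symm_val (σ : ∀ n, Equiv.Perm (X n)) (hσ : ∀ n, σ n (x₀ n) = x₀ n)
    (y : RestrictedProd X x₀) (n : ℕ) :
    ((prodPerm σ hσ).symm y).1 n = (σ n).symm (y.1 n) := rfl

/-- The restriction of `f ∈ ℓ²(∏' X)` to the line through `y` in the `n`-th direction. -/
def slice (n : ℕ) (f : EllTwo (RestrictedProd X x₀)) (y : RestrictedProd X x₀) : EllTwo (X n) :=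
  ⟨fun a => f (update n y a), (EllTwo.memℓp_iff _).2 <| ne_top_of_le_ne_top
    ((EllTwo.memℓp_iff _).1 f.2)
    (ENNReal.tsum_comp_le_tsum_of_injective (update_injective n y) fun y => ‖f y‖ₑ ^ 2)⟩

@[simp] theorem slice_apply (n : ℕ) (f : EllTwo (RestrictedProd X x₀)) (y : RestrictedProd X x₀)
    (a : X n) : slice n f y a = f (update n y a) := rfl

@[simp] theorem slice_update (n : ℕ) (f : EllTwo (RestrictedProd X x₀)) (y : RestrictedProd X x₀)
    (a : X n) : slice n f (update n y a) = slice n f y := by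
  ext b; simp

theorem slice_add (n : ℕ) (f g : EllTwo (RestrictedProd X x₀)) (y : RestrictedProd X x₀) :
    slice n (f + g) y = slice n f y + slice n g y := rfl

theorem slice_smul (n : ℕ) (c : ℂ) (f : EllTwo (RestrictedProd X x₀)) (y : RestrictedProd X x₀) :
    slice n (c • f) y = c • slice n f y := rfl

theorem tsum_slice (n : ℕ) (f : EllTwo (RestrictedProd X x₀)) :
    ∑' z : {z : RestrictedProd X x₀ // z.1 n = x₀ n}, ‖slice n f z.1‖ₑ ^ 2 = ‖f‖ₑ ^ 2 := by
  rw [← EllTwo.tsum_enorm_sq, ← (splitEquiv X x₀ n).tsum_eq, ENNReal.tsum_prod']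
  exact tsum_congr fun z => (EllTwo.tsum_enorm_sq _).symm

theorem tsum_amplify_le (n : ℕ) (T : Operators (X n)) (f : EllTwo (RestrictedProd X x₀)) :
    ∑' y : RestrictedProd X x₀, ‖T (slice n f y) (y.1 n)‖ₑ ^ 2 ≤ (‖T‖ₑ * ‖f‖ₑ) ^ 2 := by
  rw [← (splitEquiv X x₀ n).tsum_eq, ENNReal.tsum_prod', mul_pow, ← tsum_slice n f,
    ← ENNReal.tsum_mul_left]
  refine ENNReal.tsum_le_tsum fun z => ?_
  rw [← mul_pow]
  calc _ = ∑' a, ‖T (slice n f z.1) a‖ₑ ^ 2 := tsum_congr fun a => by simp [splitEquiv]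
    _ = ‖T (slice n f z.1)‖ₑ ^ 2 := EllTwo.tsum_enorm_sq _
    _ ≤ _ := by gcongr; exact T.le_opENorm _

/-- The vector `(1 ⊗ T ⊗ 1) f`, with `T` acting in the `n`-th coordinate. -/
def amplifyVec (n : ℕ) (T : Operators (X n)) (f : EllTwo (RestrictedProd X x₀)) :
    EllTwo (RestrictedProd X x₀) :=
  ⟨fun y => T (slice n f y) (y.1 n), (EllTwo.memℓp_iff _).2 <|
    ne_top_of_le_ne_top (by finiteness) (tsum_amplify_le n T f)⟩

theorem norm_amplifyVec_le (n : ℕ) (T : Operators (X n)) (f : EllTwo (RestrictedProd X x₀)) :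
    ‖amplifyVec n T f‖ ≤ ‖T‖ * ‖f‖ := by
  have h : ‖amplifyVec n T f‖ₑ ^ 2 ≤ (‖T‖ₑ * ‖f‖ₑ) ^ 2 :=
    (EllTwo.tsum_enorm_sq (amplifyVec n T f)).symm.trans_le (tsum_amplify_le n T f)
  have h' := (ENNReal.pow_le_pow_left_iff two_ne_zero).1 h
  rw [← ofReal_norm, ← ofReal_norm, ← ofReal_norm, ← ENNReal.ofReal_mul (norm_nonneg _),
    ENNReal.ofReal_le_ofReal_iff (by positivity)] at h'
  exact h'

/-- The operator `1 ⊗ T ⊗ 1` on `ℓ²(∏' X) = ⊗ₙ (ℓ²(X n), δ_{x₀ n})`, with `T` in position `n`. -/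
def amplifyOp (n : ℕ) (T : Operators (X n)) : Operators (RestrictedProd X x₀) :=
  LinearMap.mkContinuous
    { toFun := amplifyVec n T
      map_add' := fun f g => lp.ext <| funext fun y =>
        congrArg (fun h : EllTwo (X n) => h (y.1 n)) (map_add T (slice n f y) (slice n g y))
      map_smul' := fun c f => lp.ext <| funext fun y =>
        congrArg (fun h : EllTwo (X n) => h (y.1 n)) (map_smul T c (slice n f y)) }
    ‖T‖ (norm_amplifyVec_le n T)

@[simp] theorem amplifyOp_apply (n : ℕ) (T : Operators (X n)) (f : EllTwo (RestrictedProd X x₀))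
    (y : RestrictedProd X x₀) : amplifyOp n T f y = T (slice n f y) (y.1 n) := rfl

@[simp] theorem slice_amplifyOp (n : ℕ) (T : Operators (X n))
    (f : EllTwo (RestrictedProd X x₀)) (y : RestrictedProd X x₀) :
    slice n (amplifyOp n T f) y = T (slice n f y) := by
  ext a; simp

theorem inner_eq_tsum_slice (n : ℕ) (f g : EllTwo (RestrictedProd X x₀)) :
    inner ℂ f g = ∑' z : {z : RestrictedProd X x₀ // z.1 n = x₀ n},
      inner ℂ (slice n f z.1) (slice n g z.1) := by
  have hs := (splitEquiv X x₀ n).summable_iff.2 (lp.summable_inner (𝕜 := ℂ) f g)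
  rw [lp.inner_eq_tsum, ← (splitEquiv X x₀ n).tsum_eq]
  exact hs.tsum_prod

theorem amplifyOp_star (n : ℕ) (T : Operators (X n)) :
    (amplifyOp n (star T) : Operators (RestrictedProd X x₀)) = star (amplifyOp n T) := by
  rw [ContinuousLinearMap.star_eq_adjoint (amplifyOp n T)]
  refine (ContinuousLinearMap.eq_adjoint_iff _ _).2 fun f g => ?_
  simp [inner_eq_tsum_slice n, ContinuousLinearMap.star_eq_adjoint,
    ContinuousLinearMap.adjoint_inner_left]

/-- The unital `⋆`-homomorphism `T ↦ 1 ⊗ T ⊗ 1`, with `T` in position `n`. -/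
def amplify (x₀ : ∀ n, X n) (n : ℕ) :
    Operators (X n) →⋆ₐ[ℂ] Operators (RestrictedProd X x₀) where
  toFun := amplifyOp n
  map_one' := by ext f y; simp
  map_mul' S T := by ext f y; simp
  map_zero' := by ext f y; simp
  map_add' S T := by ext f y; simp
  commutes' c := by ext f y; simp [Algebra.algebraMap_eq_smul_one]
  map_star' T := amplifyOp_star n T

@[simp] theorem amplify_apply (n : ℕ) (T : Operators (X n)) (f : EllTwo (RestrictedProd X x₀))
    (y : RestrictedProd X x₀) : amplify x₀ n T f y = T (slice n f y) (y.1 n) := rfl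

theorem permAd_amplify (σ : ∀ n, Equiv.Perm (X n)) (hσ : ∀ n, σ n (x₀ n) = x₀ n)
    (n : ℕ) (T : Operators (X n)) :
    EllTwo.permAd (prodPerm σ hσ) (amplify x₀ n T) = amplify x₀ n (EllTwo.permAd (σ n) T) := by
  ext f y
  simp only [EllTwo.permAd_apply, amplify_apply]
  have h : slice n ((EllTwo.permIsometry (prodPerm σ hσ)).symm f) ((prodPerm σ hσ).symm y) =
      (EllTwo.permIsometry (σ n)).symm (slice n f y) := by
    ext a
    refine congrArg f (a₁ := prodPerm σ hσ (update n ((prodPerm σ hσ).symm y) a))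
      (a₂ := update n y (σ n a)) ?_
    refine Subtype.ext (funext fun m => ?_)
    by_cases hm : m = n
    · subst hm
      simp
    · simp [Function.update_of_ne hm]
  rw [h]
  rfl

end RestrictedProd

/-- A unital C⋆-algebra `alg` acting faithfully on a Hilbert space `ℓ²(X)` with a distinguished
unit vector `δ_base`, together with an action of `G` on it by automorphisms `a ↦ U_g a U_g⋆`, where
`U_g` is the permutation unitary of a permutation of `X` that fixes `base`. -/
structure SpatialSystem (G : Type) [Group G] where
  /-- The index set of the orthonormal basis. -/
  X : Type
  /-- The index of the distinguished unit vector. -/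
  base : X
  /-- The algebra. -/
  alg : StarSubalgebra ℂ (Operators X)
  isClosed_alg : IsClosed (alg : Set (Operators X))
  /-- The permutations implementing the action. -/
  perm : G →* Equiv.Perm X
  perm_base : ∀ g, perm g base = base
  permAd_mem : ∀ g, ∀ a ∈ alg, EllTwo.permAd (perm g) a ∈ alg

namespace SpatialSystem

variable {G : Type} [Group G]

/-- The C⋆-algebra of a system, as a type. -/
def Alg (S : SpatialSystem G) : Type := S.alg

instance (S : SpatialSystem G) : CStarAlgebra S.Alg :=
  haveI := S.isClosed_alg
  inferInstanceAs (CStarAlgebra S.alg)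

/-- `a ≤ b` if and only if `b - a` is positive. -/
instance (S : SpatialSystem G) : PartialOrder S.Alg := CStarAlgebra.spectralOrder _

instance (S : SpatialSystem G) : StarOrderedRing S.Alg := CStarAlgebra.spectralOrderedRing _

/-- The action of `G` on the C⋆-algebra of a system: `g` acts by `a ↦ U_g a U_g⋆`. -/
def action (S : SpatialSystem G) : G →* (S.Alg ≃⋆ₐ[ℂ] S.Alg) where
  toFun g :=
    { toFun := fun a => (⟨EllTwo.permAd (S.perm g) a.1, S.permAd_mem g _ a.2⟩ : S.alg)
      invFun := fun a => (⟨EllTwo.permAd (S.perm g⁻¹) a.1, S.permAd_mem g⁻¹ _ a.2⟩ : S.alg)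
      left_inv := fun a => Subtype.ext <| by
        change (EllTwo.permAd (S.perm g⁻¹) * EllTwo.permAd (S.perm g)) a.1 = a.1
        rw [← map_mul, ← map_mul]; simp
      right_inv := fun a => Subtype.ext <| by
        change (EllTwo.permAd (S.perm g) * EllTwo.permAd (S.perm g⁻¹)) a.1 = a.1
        rw [← map_mul, ← map_mul]; simp
      map_mul' := fun a b => Subtype.ext <| map_mul (EllTwo.permAd (S.perm g)) a.1 b.1
      map_add' := fun a b => Subtype.ext <| map_add (EllTwo.permAd (S.perm g)) a.1 b.1
      map_smul' := fun c a => Subtype.ext <| map_smul (EllTwo.permAd (S.perm g)) c a.1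
      map_star' := fun a => Subtype.ext <| map_star (EllTwo.permAd (S.perm g)) a.1 }
  map_one' := StarAlgEquiv.ext fun a => Subtype.ext <| by
    change EllTwo.permAd (S.perm 1) a.1 = a.1
    simp
  map_mul' g h := StarAlgEquiv.ext fun a => Subtype.ext <| by
    change EllTwo.permAd (S.perm (g * h)) a.1 =
      EllTwo.permAd (S.perm g) (EllTwo.permAd (S.perm h) a.1)
    simp

/-- The same algebra, acted on through a group homomorphism. -/
def restrict {H : Type} [Group H] (S : SpatialSystem G) (φ : H →* G) : SpatialSystem H where
  X := S.X
  base := S.base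
  alg := S.alg
  isClosed_alg := S.isClosed_alg
  perm := S.perm.comp φ
  perm_base h := S.perm_base (φ h)
  permAd_mem h := S.permAd_mem (φ h)

/-- The full matrix algebra `B(ℓ²(X))` (`X` finite) with the inner action given by permutation
matrices. -/
def matrix (X : Type) [Fintype X] (base : X) (perm : G →* Equiv.Perm X)
    (hperm : ∀ g, perm g base = base) : SpatialSystem G where
  X := X
  base := base
  alg := ⊤
  isClosed_alg := by simp
  perm := perm
  perm_base := hperm
  permAd_mem _ _ _ := trivial

section Tensor

variable {Γ : ℕ → Type} [∀ n, Group (Γ n)] (S : ∀ n, SpatialSystem (Γ n))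

/-- The index set of the basis of the infinite tensor product `⊗ₙ (ℓ²((S n).X), δ_base)`. -/
abbrev tensorIndex : Type := RestrictedProd (fun n => (S n).X) (fun n => (S n).base)

/-- The infinite minimal (spatial) tensor product of the algebras `(S n).alg`: the C⋆-algebra on
`⊗ₙ (ℓ²((S n).X), δ_base) = ℓ²(tensorIndex S)` generated by the operators
`1 ⊗ ⋯ ⊗ 1 ⊗ a ⊗ 1 ⊗ ⋯` with `a ∈ (S n).alg` in position `n`. -/
def tensorAlg : StarSubalgebra ℂ (Operators (tensorIndex S)) :=
  (⨆ n, (S n).alg.map (RestrictedProd.amplify (fun n => (S n).base) n)).topologicalClosure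

/-- The permutations implementing the tensor product action of `∏ₙ Γ n`. -/
def tensorPerm : (∀ n, Γ n) →* Equiv.Perm (tensorIndex S) where
  toFun g := RestrictedProd.prodPerm (fun n => (S n).perm (g n)) fun n => (S n).perm_base (g n)
  map_one' := by
    ext y : 1
    refine Subtype.ext (funext fun n => ?_)
    simp
  map_mul' g h := by
    ext y : 1
    refine Subtype.ext (funext fun n => ?_)
    simp

theorem tensorPerm_amplify (g : ∀ n, Γ n) (n : ℕ) (a : Operators (S n).X) :
    EllTwo.permAd (tensorPerm S g) (RestrictedProd.amplify (fun n => (S n).base) n a) =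
      RestrictedProd.amplify (fun n => (S n).base) n (EllTwo.permAd ((S n).perm (g n)) a) :=
  RestrictedProd.permAd_amplify (x₀ := fun n => (S n).base) (fun n => (S n).perm (g n))
    (fun n => (S n).perm_base (g n)) n a

theorem tensorPerm_mem (g : ∀ n, Γ n) (a : Operators (tensorIndex S)) (ha : a ∈ tensorAlg S) :
    EllTwo.permAd (tensorPerm S g) a ∈ tensorAlg S := by
  have hc := EllTwo.continuous_permAd (tensorPerm S g)
  have hcl : IsClosed ((tensorAlg S).comap (EllTwo.permAd (tensorPerm S g) :
      Operators (tensorIndex S) →⋆ₐ[ℂ] Operators (tensorIndex S)) : Set (Operators (tensorIndex S))) :=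
    (StarSubalgebra.isClosed_topologicalClosure _).preimage hc
  refine StarSubalgebra.topologicalClosure_minimal (iSup_le fun n => ?_) hcl ha
  rintro _ ⟨b, hb, rfl⟩
  refine StarSubalgebra.le_topologicalClosure _ (le_iSup (fun n => (S n).alg.map
    (RestrictedProd.amplify (fun n => (S n).base) n)) n ?_)
  exact ⟨_, (S n).permAd_mem (g n) b hb, (tensorPerm_amplify S g n b).symm⟩

/-- The infinite tensor product system: the product group `∏ₙ Γ n` acts on `⊗ₙ (S n).alg` by
`α_g (a₁ ⊗ ⋯ ⊗ aₙ ⊗ 1) = α_{g 1} (a₁) ⊗ ⋯ ⊗ α_{g n} (aₙ) ⊗ 1`. -/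
def tensor : SpatialSystem (∀ n, Γ n) where
  X := tensorIndex S
  base := RestrictedProd.base (fun n => (S n).base)
  alg := tensorAlg S
  isClosed_alg := StarSubalgebra.isClosed_topologicalClosure _
  perm := tensorPerm S
  perm_base g := Subtype.ext (funext fun n => (S n).perm_base (g n))
  permAd_mem := tensorPerm_mem S

/-- The embedding `a ↦ 1 ⊗ ⋯ ⊗ 1 ⊗ a ⊗ 1 ⊗ ⋯` of the `n`-th tensor factor. -/
def tensorEmb (n : ℕ) : (S n).Alg →⋆ₐ[ℂ] (tensor S).Alg :=
  (((RestrictedProd.amplify (fun n => (S n).base) n).comp (S n).alg.subtype).codRestrict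
    (tensorAlg S) fun a => StarSubalgebra.le_topologicalClosure _ (le_iSup (fun n =>
      (S n).alg.map (RestrictedProd.amplify (fun n => (S n).base) n)) n ⟨a.1, a.2, rfl⟩) :
    (S n).alg →⋆ₐ[ℂ] tensorAlg S)

theorem action_tensorEmb (g : ∀ n, Γ n) (n : ℕ) (a : (S n).Alg) :
    (tensor S).action g (tensorEmb S n a) = tensorEmb S n ((S n).action (g n) a) :=
  Subtype.ext (tensorPerm_amplify S g n a.1)

end Tensor

end SpatialSystem

/-! ### The action -/

/-- The group `ℤ/2`, written multiplicatively, with the discrete topology. -/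
abbrev ZTwo : Type := Multiplicative (ZMod 2)

/-- `r(k) = (3 ^ k - 1) / 2`. -/
def blockSize (k : ℕ) : ℕ := (3 ^ k - 1) / 2

/-- The index set of the standard basis of `ℂ^(3 ^ k)`, in blocks of sizes `r(k)`, `r(k)`, `1`. -/
abbrev BlockIndex (k : ℕ) : Type := Fin (blockSize k) ⊕ (Fin (blockSize k) ⊕ Unit)

theorem card_blockIndex (k : ℕ) : Fintype.card (BlockIndex k) = 3 ^ k := by
  obtain ⟨m, hm⟩ : Odd (3 ^ k) := Odd.pow (by decide)
  rw [Fintype.card_sum, Fintype.card_sum, Fintype.card_fin, Fintype.card_unit, blockSize, hm]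
  omega

/-- The permutation exchanging the two blocks of size `r(k)` and fixing the last index. -/
def blockSwap (k : ℕ) : Equiv.Perm (BlockIndex k) where
  toFun
    | .inl i => .inr (.inl i)
    | .inr (.inl i) => .inl i
    | .inr (.inr u) => .inr (.inr u)
  invFun
    | .inl i => .inr (.inl i)
    | .inr (.inl i) => .inl i
    | .inr (.inr u) => .inr (.inr u)
  left_inv := by rintro (i | i | u) <;> rfl
  right_inv := by rintro (i | i | u) <;> rfl

theorem blockSwap_sq (k : ℕ) : blockSwap k ^ 2 = 1 := by
  ext x : 1
  rw [sq]
  rcases x with i | i | u <;> rfl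

/-- The permutation matrix of `blockSwap k` is the block unitary `w_k = [0 1 0; 1 0 0; 0 0 1]`. -/
theorem blockSwap_matrix (k : ℕ) :
    (Matrix.of fun i j => if i = blockSwap k j then 1 else 0 :
      Matrix (BlockIndex k) (BlockIndex k) ℂ) =
    Matrix.fromBlocks 0 (Matrix.fromCols 1 0) (Matrix.fromRows 1 0)
      (Matrix.fromBlocks 0 0 0 1) := by
  ext (i | i | i) (j | j | j) <;> simp [blockSwap, Matrix.one_apply]

/-- The homomorphism from `ℤ/2` determined by an element of order at most `2`. -/
def ofInvolution {P : Type} [Group P] (w : P) (hw : w ^ 2 = 1) : ZTwo →* P where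
  toFun g := w ^ (Multiplicative.toAdd g).val
  map_one' := by simp
  map_mul' g h := by
    rw [toAdd_mul, ZMod.val_add, ← pow_add, ← pow_eq_pow_mod _ hw]

theorem ofInvolution_blockSwap_base (k : ℕ) (g : ZTwo) :
    ofInvolution (blockSwap k) (blockSwap_sq k) g (.inr (.inr ())) = .inr (.inr ()) := by
  have h : Function.IsFixedPt (blockSwap k) (.inr (.inr ())) := rfl
  have := h.iterate (Multiplicative.toAdd g).val
  rw [Equiv.Perm.iterate_eq_pow] at this
  exact this

/-- `M_{3 ^ k}` with the action of `ℤ/2` generated by `Ad w_k`. -/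
def matrixSystem (k : ℕ) : SpatialSystem ZTwo :=
  SpatialSystem.matrix (BlockIndex k) (.inr (.inr ()))
    (ofInvolution (blockSwap k) (blockSwap_sq k)) (ofInvolution_blockSwap_base k)

/-- The `3^∞` UHF algebra `B = ⊗_{k ≥ 1} M_{3 ^ k}` with the product type action of `ℤ/2` generated
by `ν = ⊗_{k ≥ 1} Ad w_k`, that is, the tensor product action of `∏_{k ≥ 1} ℤ/2` restricted to the
diagonal. -/
def uhfSystem : SpatialSystem ZTwo :=
  (SpatialSystem.tensor fun k => matrixSystem (k + 1)).restrict
    (MonoidHom.pi fun _ => MonoidHom.id ZTwo)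

/-- `A = ⊗_n B` with the infinite tensor product action of `G = ∏_n ℤ/2`. -/
def infSystem : SpatialSystem (ℕ → ZTwo) := SpatialSystem.tensor fun _ => uhfSystem

/-- The C⋆-algebra `A = ⊗_n B`. -/
abbrev InfAlg : Type := infSystem.Alg

/-- The infinite tensor product action of `G = ∏_n ℤ/2` on `A = ⊗_n B`. -/
def infAction : (ℕ → ZTwo) →* (InfAlg ≃⋆ₐ[ℂ] InfAlg) := infSystem.action

/-! ### Tracial Rokhlin properties -/

open scoped CStarAlgebra ComplexOrder

/-- Cuntz subequivalence of elements `a`, `b` of a C⋆-algebra `D`: there is a sequence `v` in `D`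
with `v n * b * (v n)⋆ → a`. -/
def CuntzLE {D : Type*} [Mul D] [Star D] [TopologicalSpace D] (a b : D) : Prop :=
  ∃ v : ℕ → D, Filter.Tendsto (fun n => v n * b * star (v n)) Filter.atTop (nhds a)

section Rokhlin

variable {G : Type*} [Group G] {A : Type*} [CStarAlgebra A]

/-- The fixed point algebra `A^α`. -/
def fixedPoints (α : G →* (A ≃⋆ₐ[ℂ] A)) : StarSubalgebra ℂ A where
  carrier := {a | ∀ g, α g a = a}
  mul_mem' ha hb g := by rw [map_mul, ha g, hb g]
  add_mem' ha hb g := by rw [map_add, ha g, hb g]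
  algebraMap_mem' c g := by
    rw [Algebra.algebraMap_eq_smul_one, map_smul, map_one]
  star_mem' ha g := by rw [map_star, ha g]

/-- `φ` is an `(S, F, ε)`-approximately equivariant central multiplicative map. -/
structure IsApproxEquivariantCentralMultiplicative {D : Type*} [CStarAlgebra D]
    (γ : G →* (D ≃⋆ₐ[ℂ] D)) (α : G →* (A ≃⋆ₐ[ℂ] A)) (S : Set D) (F : Set A) (ε : ℝ)
    (φ : D → A) : Prop where
  mul : ∀ x ∈ S, ∀ y ∈ S, ‖φ (x * y) - φ x * φ y‖ < ε
  central : ∀ x ∈ S, ∀ a ∈ F, ‖φ x * a - a * φ x‖ < ε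
  equivariant : ∀ x ∈ S, ⨆ g, ‖φ (γ g x) - α g (φ x)‖ₑ < ENNReal.ofReal ε

/-- The action of `G` on `C(G)` by left translation, `(Lt g f)(h) = f(g⁻¹ h)`. -/
def leftTranslation (G : Type*) [Group G] [TopologicalSpace G] [IsTopologicalGroup G] :
    G →* (C(G, ℂ) ≃⋆ₐ[ℂ] C(G, ℂ)) where
  toFun g :=
    { toFun := fun f => f.comp ⟨fun h => g⁻¹ * h, by fun_prop⟩
      invFun := fun f => f.comp ⟨fun h => g * h, by fun_prop⟩
      left_inv := fun f => by ext h; simp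
      right_inv := fun f => by ext h; simp
      map_mul' := fun _ _ => rfl
      map_add' := fun _ _ => rfl
      map_smul' := fun _ _ => rfl
      map_star' := fun _ => rfl }
  map_one' := by ext f h; simp
  map_mul' g₁ g₂ := by ext f h; simp [mul_assoc]

variable [PartialOrder A] [StarOrderedRing A]
  [TopologicalSpace G] [IsTopologicalGroup G] [CompactSpace G]

/-- The completely positive map `φ : C(G) → A` is a unital completely positive map from `C(G)` to
the corner `p A p` (whose unit is `p`). -/
structure IsUnitalIntoCorner (φ : C(G, ℂ) →CP A) (p : A) : Prop where
  map_one : φ 1 = p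
  mem_corner : ∀ f, p * φ f * p = φ f

/-- The conditions on `p` and `φ` in the restricted tracial Rokhlin property with comparison. -/
structure RestrictedTRPCConditions (α : G →* (A ≃⋆ₐ[ℂ] A)) (F : Set A) (S : Set C(G, ℂ)) (ε : ℝ)
    (x : A) (y p : fixedPoints α) (φ : C(G, ℂ) →CP A) : Prop where
  isStarProjection : IsStarProjection p
  isUnitalIntoCorner : IsUnitalIntoCorner φ (p : A)
  approx : IsApproxEquivariantCentralMultiplicative (leftTranslation G) α S F ε φ
  compl_le_x : CuntzLE (1 - (p : A)) x
  compl_le_y : CuntzLE (1 - p) y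
  compl_le_self : CuntzLE (1 - p) p

/-- The conditions on `p` and `φ` in the tracial Rokhlin property with comparison. -/
structure TRPCConditions (α : G →* (A ≃⋆ₐ[ℂ] A)) (F : Set A) (S : Set C(G, ℂ)) (ε : ℝ)
    (x : A) (y p : fixedPoints α) (φ : C(G, ℂ) →CP A) : Prop
    extends RestrictedTRPCConditions α F S ε x y p φ where
  norm_compress : 1 - ε < ‖(p : A) * x * p‖

/-- The conditions on `p`, `s` and `φ` in the strong modified tracial Rokhlin property. -/
structure StrongModifiedTRPConditions (α : G →* (A ≃⋆ₐ[ℂ] A)) (F : Set A) (S : Set C(G, ℂ))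
    (ε : ℝ) (x : A) (p s : fixedPoints α) (φ : C(G, ℂ) →CP A) : Prop where
  isStarProjection : IsStarProjection p
  isPartialIsometry : s * star s * s = s
  isUnitalIntoCorner : IsUnitalIntoCorner φ (p : A)
  contractive : ∀ f, ‖φ f‖ ≤ ‖f‖
  approx : IsApproxEquivariantCentralMultiplicative (leftTranslation G) α S F ε φ
  compl_le_x : CuntzLE (1 - (p : A)) x
  star_mul_self : star s * s = 1 - p
  mul_star_self : (s : A) * star (s : A) ≤ p
  commute : ∀ a ∈ F, ‖(s : A) * a - a * s‖ < ε
  norm_compress : 1 - ε < ‖(p : A) * x * p‖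

/-- The tracial Rokhlin property with comparison for a continuous action of a second countable
compact group on an infinite dimensional simple unital C⋆-algebra. (For a unital C⋆-algebra,
algebraic simplicity is the same as having no nontrivial closed two-sided ideals.) -/
structure HasTracialRokhlinPropertyWithComparison [T2Space G] [SecondCountableTopology G]
    (α : G →* (A ≃⋆ₐ[ℂ] A)) : Prop where
  infinite_dimensional : ¬ FiniteDimensional ℂ A
  simple : IsSimpleRing A
  continuous : ∀ a, Continuous fun g => α g a
  exists_projection : ∀ (F : Finset A) (S : Finset C(G, ℂ)) (ε : ℝ), 0 < ε →
    ∀ x : A, 0 ≤ x → ‖x‖ = 1 → ∀ y : fixedPoints α, 0 ≤ (y : A) → y ≠ 0 →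
    ∃ (p : fixedPoints α) (φ : C(G, ℂ) →CP A), TRPCConditions α F S ε x y p φ

/-- The strong modified tracial Rokhlin property for a continuous action of a second countable
compact group on an infinite dimensional simple separable unital C⋆-algebra. -/
structure HasStrongModifiedTracialRokhlinProperty [T2Space G] [SecondCountableTopology G]
    (α : G →* (A ≃⋆ₐ[ℂ] A)) : Prop where
  infinite_dimensional : ¬ FiniteDimensional ℂ A
  simple : IsSimpleRing A
  separable : TopologicalSpace.SeparableSpace A
  continuous : ∀ a, Continuous fun g => α g a
  exists_projection : ∀ (F : Finset A) (S : Finset C(G, ℂ)) (ε : ℝ), 0 < ε →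
    ∀ x : A, 0 ≤ x → ‖x‖ = 1 →
    ∃ (p s : fixedPoints α) (φ : C(G, ℂ) →CP A), StrongModifiedTRPConditions α F S ε x p s φ

end Rokhlin

end

open scoped CStarAlgebra ComplexOrder

/-!
`A` acts on the Hilbert space whose basis vectors are families `z` indexed by the slots `(n, k)`,
where the slot `(n, k)` stands for the tensor factor `M_{3 ^ (k + 1)}` of the `n`-th copy of `B`.
The group `G` permutes the basis, its `n`-th entry acting on the slots `(n, k)` for all `k`. In one
slot the action exchanges two blocks of `(3 ^ (k + 1) - 1) / 2` basis vectors and fixes the last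
basis vector. The slots in a finite set `I` carry a matrix algebra contained in `A`, and the matrix
algebras of the boxes `{(n, k) | n, k < K}` are increasing with dense union. So finitely many
elements of `A` are approximated by matrices in one box, and a continuous function on `G` is
approximated by functions of the first `K` entries, that is, on `H = ∏_{n < K} ℤ/2`.

*The Rokhlin map.* Let `L ≥ K` and look at the column `{(n, L) | n < K}`, which is disjoint from the
box. On its basis vectors `t` the group `G` acts through `H`, and the orbit of `t` is free exactly
if no value `t (n, L)` is the last one; then the blocks of the values give an equivariant map to
`H`. Let `p` be the projection onto the vectors with free orbits, whose complement is `nonfreeProj`,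
and let `φ f` be the diagonal matrix which evaluates `f` at the blocks (`rokhlinHom`). This is a
homomorphism into `p A p` which commutes with the box and is equivariant on functions of the first
`K` entries. Compression by `p` is isometric on the box, as `p` dominates a minimal projection of
the column.

*Comparison.* If `L` is large, then non-free vectors are so rare that the pairs of a basis vector of
the box and a non-free vector of the column embed into the set of vectors in first blocks, which
represent distinct free orbits (`exists_isTransfer`). Fix a basis vector `z` of the box. The
embedding `θ` defines a matrix `W` which maps `(i, t)`, with `t` not free, to `(z, θ (i, t))`. For a
matrix `m` of the box, `W* (m ⊗ 1) W = m z z • (1 - p)`, and different translates of `W` under `H`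
have orthogonal ranges, even with `m ⊗ 1` in between (`star_transferMatrix_mul`). So the normalized
sum `V` of the translates is invariant and `V* (m ⊗ 1) V` is `1 - p` times the average of the
diagonal entries of `m` along the orbit of `z`. A nonzero positive `y` has a positive diagonal
coefficient `c` at some basis vector, and if `y` is fixed by `G`, the coefficient is constant along
orbits. Hence `V* y V` is close to `c (1 - p)`, and functional calculus in the corner gives
`1 - p = v y v*` for an invariant `v` (`exists_conj_eq_star_mul_self`). Without averaging this
yields `1 - p = v x v*` for each nonzero `x ≥ 0`. The same construction with the column alone gives
an invariant partial isometry `s` with `s* s = 1 - p` and `s s* ≤ p` which commutes with the box.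

*Simplicity.* By the above, a nonzero ideal contains some `1 - p` with `K ≥ 1`, a nonzero
element of a full matrix algebra with the unit of `A`, and thus contains `1`.
-/

noncomputable section

open scoped ENNReal

/-! ### Matrices acting in a finite coordinate -/

/-- A coordinate on `Z` with values in `Y`: a function `get` which can be overwritten freely. The
laws say that `Z` is a product `Y × R` on which `get` is the first projection. -/
@[ext] structure Coordinate (Z Y : Type) where
  /-- The value of the coordinate. -/
  get : Z → Y
  /-- Overwrite the coordinate. -/
  set : Z → Y → Z
  get_set : ∀ z i, get (set z i) = i
  set_get : ∀ z, set z (get z) = z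
  set_set : ∀ z i j, set (set z i) j = set z j

namespace Coordinate

attribute [simp] get_set set_get set_set

variable {Z Y W : Type}

/-- A point of `Z` as a coordinate on itself. -/
@[simps] protected def id (Z : Type) : Coordinate Z Z where
  get z := z
  set _ z := z
  get_set _ _ := rfl
  set_get _ := rfl
  set_set _ _ _ := rfl

/-- The coordinate with one value. -/
def unit (Z : Type) : Coordinate Z Unit where
  get _ := ()
  set z _ := z
  get_set _ _ := rfl
  set_get _ := rfl
  set_set _ _ _ := rfl

/-- A coordinate of a coordinate. -/
@[simps] def comp (d : Coordinate Y W) (c : Coordinate Z Y) : Coordinate Z W where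
  get z := d.get (c.get z)
  set z i := c.set z (d.set (c.get z) i)
  get_set _ _ := by simp
  set_get _ := by simp
  set_set _ _ _ := by simp

/-- The first coordinate of a product. -/
@[simps] def fst (Y W : Type) : Coordinate (Y × W) Y where
  get p := p.1
  set p i := (i, p.2)
  get_set _ _ := rfl
  set_get _ := rfl
  set_set _ _ _ := rfl

/-- The second coordinate of a product. -/
@[simps] def snd (Y W : Type) : Coordinate (Y × W) W where
  get p := p.2
  set p i := (p.1, i)
  get_set _ _ := rfl
  set_get _ := rfl
  set_set _ _ _ := rfl

/-- Two coordinates are independent if overwriting one does not affect the other. -/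
structure Indep (c : Coordinate Z Y) (d : Coordinate Z W) : Prop where
  get_left : ∀ z j, c.get (d.set z j) = c.get z
  get_right : ∀ z i, d.get (c.set z i) = d.get z
  set_comm : ∀ z i j, c.set (d.set z j) i = d.set (c.set z i) j

/-- The pair of two independent coordinates. -/
@[simps] def prod (c : Coordinate Z Y) (d : Coordinate Z W) (h : Indep c d) :
    Coordinate Z (Y × W) where
  get z := (c.get z, d.get z)
  set z p := c.set (d.set z p.2) p.1
  get_set z p := by simp [h.get_right]
  set_get z := by simp
  set_set z p q := by simp [h.set_comm]

theorem fst_comp_prod (c : Coordinate Z Y) (d : Coordinate Z W) (h : Indep c d) :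
    (fst Y W).comp (c.prod d h) = c := by
  ext z i
  · rfl
  · simp

theorem snd_comp_prod (c : Coordinate Z Y) (d : Coordinate Z W) (h : Indep c d) :
    (snd Y W).comp (c.prod d h) = d := by
  ext z i
  · rfl
  · simp [h.set_comm]

/-- The permutation of `Z` induced by a permutation of the values of a coordinate. -/
@[simps] def permute (c : Coordinate Z Y) (τ : Equiv.Perm Y) : Equiv.Perm Z where
  toFun z := c.set z (τ (c.get z))
  invFun z := c.set z (τ.symm (c.get z))
  left_inv z := by simp
  right_inv z := by simp

variable [DecidableEq Y]

theorem tsum_matrixUnit_le (c : Coordinate Z Y) (i j : Y) (f : EllTwo Z) :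
    ∑' z, ‖if c.get z = i then f (c.set z j) else 0‖ₑ ^ 2 ≤ ‖f‖ₑ ^ 2 := by
  rw [← (c.permute (Equiv.swap i j)).tsum_eq, ← EllTwo.tsum_enorm_sq]
  refine ENNReal.tsum_le_tsum fun z => ?_
  by_cases h : c.get z = j
  · simp [← h]
  · have : Equiv.swap i j (c.get z) ≠ i := fun h' => h (by
      rw [Equiv.swap_apply_eq_iff] at h'; simpa using h')
    simp [this]

/-- The matrix unit `e_{ij}` acting in a coordinate: `e_{ij} δ_z` is `δ_{z'}` if the coordinate of
`z` is `j`, where `z'` arises from `z` by overwriting the coordinate by `i`, and `0` otherwise. -/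
def matrixUnit (c : Coordinate Z Y) (i j : Y) : Operators Z :=
  LinearMap.mkContinuous
    { toFun := fun f => ⟨fun z => if c.get z = i then f (c.set z j) else 0,
        (EllTwo.memℓp_iff _).2 <| ne_top_of_le_ne_top (by finiteness)
          (c.tsum_matrixUnit_le i j f)⟩
      map_add' := fun f g => by
        ext z
        change (if _ then f _ + g _ else 0) = (if _ then f _ else 0) + (if _ then g _ else 0)
        split_ifs <;> simp
      map_smul' := fun a f => by
        ext z
        change (if _ then a * f _ else 0) = a * (if _ then f _ else 0)
        split_ifs <;> simp } 1 fun f => by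
    rw [one_mul, ← enorm_le_iff_norm_le]
    refine (ENNReal.pow_le_pow_left_iff two_ne_zero).1 ?_
    rw [← EllTwo.tsum_enorm_sq]
    exact c.tsum_matrixUnit_le i j f

@[simp] theorem matrixUnit_apply (c : Coordinate Z Y) (i j : Y) (f : EllTwo Z) (z : Z) :
    c.matrixUnit i j f z = if c.get z = i then f (c.set z j) else 0 := rfl

theorem star_matrixUnit (c : Coordinate Z Y) (i j : Y) :
    star (c.matrixUnit i j) = c.matrixUnit j i := by
  rw [ContinuousLinearMap.star_eq_adjoint, eq_comm]
  refine (ContinuousLinearMap.eq_adjoint_iff _ _).2 fun f g => ?_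
  rw [lp.inner_eq_tsum, lp.inner_eq_tsum, ← (c.permute (Equiv.swap i j)).tsum_eq]
  refine tsum_congr fun z => ?_
  by_cases h : c.get z = i
  · simp [← h]
  · have : Equiv.swap i j (c.get z) ≠ j := fun h' => h (by
      rw [Equiv.swap_apply_eq_iff] at h'; simpa using h')
    simp [this, h]

variable [Fintype Y]

theorem sum_smul_matrixUnit_apply (c : Coordinate Z Y) (m : Matrix Y Y ℂ) (f : EllTwo Z) (z : Z) :
    (∑ i, ∑ j, m i j • c.matrixUnit i j : Operators Z) f z =
      ∑ j, m (c.get z) j * f (c.set z j) := by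
  simp only [sum_apply, smul_apply, lp.coeFn_sum,
    Finset.sum_apply, lp.coeFn_smul, Pi.smul_apply, matrixUnit_apply, smul_eq_mul]
  rw [Finset.sum_comm]
  simp

/-- Matrices with index set `Y` acting in a `Y`-valued coordinate. If `Z = Y × R`, this is
`m ↦ m ⊗ 1` on `ℓ²(Z) = ℓ²(Y) ⊗ ℓ²(R)`. -/
def amp (c : Coordinate Z Y) : Matrix Y Y ℂ →⋆ₐ[ℂ] Operators Z where
  toFun m := ∑ i, ∑ j, m i j • c.matrixUnit i j
  map_one' := by
    ext f z
    rw [sum_smul_matrixUnit_apply]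
    simp [Matrix.one_apply]
  map_mul' m n := by
    ext f z
    change _ = (∑ i, ∑ j, m i j • c.matrixUnit i j : Operators Z)
      ((∑ i, ∑ j, n i j • c.matrixUnit i j : Operators Z) f) z
    simp only [sum_smul_matrixUnit_apply]
    simp only [get_set, set_set, Matrix.mul_apply, Finset.sum_mul,
      Finset.mul_sum, mul_assoc]
    exact Finset.sum_comm
  map_zero' := by simp
  map_add' m n := by simp [add_smul, Finset.sum_add_distrib]
  commutes' a := by
    ext f z
    rw [sum_smul_matrixUnit_apply]
    simp [Algebra.algebraMap_eq_smul_one, Matrix.one_apply]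
  map_star' m := by
    simp only [star_sum, star_smul, star_matrixUnit, Matrix.star_apply]
    exact Finset.sum_comm

@[simp] theorem amp_apply (c : Coordinate Z Y) (m : Matrix Y Y ℂ) (f : EllTwo Z) (z : Z) :
    c.amp m f z = ∑ j, m (c.get z) j * f (c.set z j) :=
  c.sum_smul_matrixUnit_apply m f z

theorem amp_single (c : Coordinate Z Y) (i j : Y) :
    c.amp (Matrix.single i j 1) = c.matrixUnit i j := by
  ext f z
  simp only [amp_apply, Matrix.single_apply, matrixUnit_apply, ite_mul, one_mul, zero_mul,
    ite_and]
  by_cases h : c.get z = i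
  · simp [h]
  · simp [h, Ne.symm h]

theorem amp_eq_sum (c : Coordinate Z Y) (m : Matrix Y Y ℂ) :
    c.amp m = ∑ i, ∑ j, m i j • c.matrixUnit i j := rfl

/-- Every operator on a finite-dimensional `ℓ²` is given by a matrix. -/
theorem exists_amp_id_eq (T : Operators Y) : ∃ m, (Coordinate.id Y).amp m = T := by
  refine ⟨Matrix.of fun i j => T (lp.single 2 j (1 : ℂ)) i, ?_⟩
  ext f i
  have hf : f = ∑ j, f j • (lp.single 2 j (1 : ℂ) : EllTwo Y) := by
    ext k
    rw [lp.coeFn_sum, Finset.sum_apply, Finset.sum_eq_single k]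
    · simp
    · intro j _ hj
      simp [Pi.single_eq_of_ne hj.symm]
    · simp
  conv_rhs => rw [hf, map_sum, lp.coeFn_sum, Finset.sum_apply]
  simp [mul_comm]

/-- The diagonal matrix coefficients of `m ⊗ 1` are those of `m`. -/
theorem amp_single_apply_self [DecidableEq Z] (c : Coordinate Z Y) (m : Matrix Y Y ℂ) (z : Z) :
    c.amp m (lp.single 2 z (1 : ℂ)) z = m (c.get z) (c.get z) := by
  rw [amp_apply, Finset.sum_eq_single (c.get z)]
  · simp
  · intro j _ hj
    rw [lp.single_apply_ne, mul_zero]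
    intro h
    exact hj (by simpa using congrArg c.get h)
  · simp

variable [DecidableEq W] [Fintype W]

/-- `m ↦ m ⊗ 1` for matrices, along a coordinate of a finite set. -/
def lift (d : Coordinate Y W) (m : Matrix W W ℂ) : Matrix Y Y ℂ :=
  Matrix.of fun i j => if j = d.set i (d.get j) then m (d.get i) (d.get j) else 0

theorem amp_comp (d : Coordinate Y W) (c : Coordinate Z Y) (m : Matrix W W ℂ) :
    (d.comp c).amp m = c.amp (d.lift m) := by
  ext f z
  simp only [amp_apply, comp_get, comp_set, lift, Matrix.of_apply, ite_mul, zero_mul]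
  rw [← Finset.sum_filter]
  refine Finset.sum_bij (fun w _ => d.set (c.get z) w) ?_ ?_ ?_ ?_
  · simp
  · intro a _ b _ h
    simpa using congrArg d.get h
  · intro j hj
    refine ⟨d.get j, by simp, ?_⟩
    simpa [eq_comm] using hj
  · simp

/-- Permutation unitaries act on `m ⊗ 1` through the permutation they induce on the coordinate. -/
theorem permAd_amp (c : Coordinate Z Y) (σ : Equiv.Perm Z) (τ : Equiv.Perm Y)
    (hget : ∀ z, c.get (σ z) = τ (c.get z)) (hset : ∀ z i, c.set (σ z) (τ i) = σ (c.set z i))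
    (m : Matrix Y Y ℂ) :
    EllTwo.permAd σ (c.amp m) = c.amp (m.submatrix τ.symm τ.symm) := by
  ext f z
  have hget' : c.get (σ.symm z) = τ.symm (c.get z) := by
    rw [Equiv.eq_symm_apply, ← hget, Equiv.apply_symm_apply]
  rw [EllTwo.permAd_apply, amp_apply, amp_apply,
    ← Equiv.sum_comp τ fun j => m.submatrix τ.symm τ.symm (c.get z) j * f (c.set z j)]
  refine Finset.sum_congr rfl fun j _ => ?_
  simp only [Matrix.submatrix_apply, hget', Equiv.symm_apply_apply]
  congr 1
  change f (σ (c.set (σ.symm z) j)) = _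
  rw [← hset, Equiv.apply_symm_apply]

end Coordinate

/-! ### The tensor factors of `A` -/

/-- The coordinate of a restricted product. -/
@[simps] def RestrictedProd.coord (X : ℕ → Type) (x₀ : ∀ n, X n) (n : ℕ) :
    Coordinate (RestrictedProd X x₀) (X n) where
  get z := z.1 n
  set z a := RestrictedProd.update n z a
  get_set _ _ := by simp
  set_get _ := by simp
  set_set _ _ _ := by simp

theorem RestrictedProd.amplify_amp {X : ℕ → Type} (x₀ : ∀ n, X n) (n : ℕ) {Y : Type}
    [DecidableEq Y] [Fintype Y] (d : Coordinate (X n) Y) (m : Matrix Y Y ℂ) :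
    RestrictedProd.amplify x₀ n (d.amp m) = (d.comp (RestrictedProd.coord X x₀ n)).amp m := by
  ext f y
  simp

/-- The index set of the basis of the Hilbert space on which `B` acts. -/
abbrev UHFIndex : Type :=
  RestrictedProd (fun k : ℕ => BlockIndex (k + 1)) (fun _ => .inr (.inr ()))

/-- The index set of the basis of the Hilbert space on which `A` acts. Its elements are families
indexed by the slots `(n, k)`, which stand for the `k`-th factor of the `n`-th copy of `B`. -/
abbrev InfIndex : Type :=
  RestrictedProd (fun _ : ℕ => UHFIndex) (fun _ => RestrictedProd.base _)

/-- The values of the coordinates in the slots `s ∈ I`. -/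
abbrev SlotValues (I : Finset (ℕ × ℕ)) : Type := (s : I) → BlockIndex (s.1.2 + 1)

/-- The group action on the values in the slots of `I`. -/
def slotPerm (I : Finset (ℕ × ℕ)) : (ℕ → ZTwo) →* Equiv.Perm (SlotValues I) where
  toFun g := Equiv.piCongrRight fun s =>
    ofInvolution (blockSwap (s.1.2 + 1)) (blockSwap_sq _) (g s.1.1)
  map_one' := by ext; simp
  map_mul' g h := by ext; simp

@[simp] theorem slotPerm_apply (I : Finset (ℕ × ℕ)) (g : ℕ → ZTwo) (i : SlotValues I) (s : I) :
    slotPerm I g i s = ofInvolution (blockSwap (s.1.2 + 1)) (blockSwap_sq _) (g s.1.1) (i s) := rfl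

/-- The coordinates in the slots of `I`. -/
def slots (I : Finset (ℕ × ℕ)) : Coordinate InfIndex (SlotValues I) where
  get z s := (z.1 s.1.1).1 s.1.2
  set z i := ⟨fun n => ⟨fun k => if h : (n, k) ∈ I then i ⟨(n, k), h⟩ else (z.1 n).1 k, by
    refine ((z.1 n).2.union (I.image Prod.snd).finite_toSet).subset fun k hk => ?_
    by_cases h : (n, k) ∈ I
    · exact Or.inr (by simpa using ⟨n, h⟩)
    · exact Or.inl (by simpa [h] using hk)⟩, by
    refine (z.2.union (I.image Prod.fst).finite_toSet).subset fun n hn => ?_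
    by_cases h : ∃ k, (n, k) ∈ I
    · exact Or.inr (by simpa using h)
    · refine Or.inl fun hz => hn ?_
      push Not at h
      rw [← hz]
      exact Subtype.ext (funext fun k => by simp [h])⟩
  get_set z i := by ext s; simp
  set_get z := Subtype.ext <| funext fun n => Subtype.ext <| funext fun k => by simp
  set_set z i j := Subtype.ext <| funext fun n => Subtype.ext <| funext fun k => by
    simp only; split_ifs <;> rfl

@[simp] theorem slots_get (I : Finset (ℕ × ℕ)) (z : InfIndex) (s : I) :
    (slots I).get z s = (z.1 s.1.1).1 s.1.2 := rfl

theorem slots_set (I : Finset (ℕ × ℕ)) (z : InfIndex) (i : SlotValues I) (n k : ℕ) :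
    (((slots I).set z i).1 n).1 k = if h : (n, k) ∈ I then i ⟨(n, k), h⟩ else (z.1 n).1 k := rfl

theorem InfIndex.ext {y z : InfIndex} (h : ∀ n k, (y.1 n).1 k = (z.1 n).1 k) : y = z :=
  Subtype.ext <| funext fun n => Subtype.ext <| funext fun k => h n k

theorem slots_indep {I J : Finset (ℕ × ℕ)} (h : Disjoint I J) :
    Coordinate.Indep (slots I) (slots J) where
  get_left z j := by
    ext s
    simp [slots_set, Finset.disjoint_left.1 h s.2]
  get_right z j := by
    ext s
    simp [slots_set, Finset.disjoint_right.1 h s.2]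
  set_comm z i j := InfIndex.ext fun n k => by
    simp only [slots_set]
    by_cases hI : (n, k) ∈ I
    · simp [hI, Finset.disjoint_left.1 h hI]
    · simp [hI]

/-- The `k`-th coordinate of the basis for `B`. -/
def uhfSlot (k : ℕ) : Coordinate UHFIndex (BlockIndex (k + 1)) :=
  (Coordinate.id _).comp (RestrictedProd.coord (fun k => BlockIndex (k + 1)) _ k)

/-- The coordinate in a single slot. -/
def slot (n k : ℕ) : Coordinate InfIndex (BlockIndex (k + 1)) :=
  (uhfSlot k).comp (RestrictedProd.coord (fun _ => UHFIndex) _ n)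

theorem slot_set (n k : ℕ) (z : InfIndex) (a : BlockIndex (k + 1)) :
    (slot n k).set z a =
      RestrictedProd.update n z (RestrictedProd.update k (z.1 n) a) := rfl

theorem slot_set_same (n k : ℕ) (z : InfIndex) (a : BlockIndex (k + 1)) :
    (((slot n k).set z a).1 n).1 k = a := by
  simp [slot_set]

theorem slot_set_of_ne (n k : ℕ) (z : InfIndex) (a : BlockIndex (k + 1)) (n' k' : ℕ)
    (h : (n', k') ≠ (n, k)) : (((slot n k).set z a).1 n').1 k' = (z.1 n').1 k' := by
  rw [slot_set]
  by_cases hn : n' = n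
  · subst hn
    have hk : k' ≠ k := fun hk => h (by rw [hk])
    simp [hk]
  · simp [Function.update_of_ne hn]

/-- A single slot as a coordinate of the values in `I`. -/
@[simps] def evalSlot {I : Finset (ℕ × ℕ)} (s : I) :
    Coordinate (SlotValues I) (BlockIndex (s.1.2 + 1)) where
  get i := i s
  set i a := Function.update i s a
  get_set _ _ := by simp
  set_get _ := by simp
  set_set _ _ _ := by simp

theorem evalSlot_comp_slots {I : Finset (ℕ × ℕ)} (s : I) :
    (evalSlot s).comp (slots I) = slot s.1.1 s.1.2 := by
  refine Coordinate.ext rfl (funext fun z => funext fun a => InfIndex.ext fun n k => ?_)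
  by_cases h : (n, k) = s.1
  · obtain ⟨⟨n', k'⟩, hs⟩ := s
    obtain ⟨rfl, rfl⟩ := Prod.mk.inj h
    rw [slot_set_same]
    simp [slots_set, hs]
  · rw [slot_set_of_ne _ _ _ _ _ _ h]
    have h' (hI : (n, k) ∈ I) : (⟨(n, k), hI⟩ : I) ≠ s := fun e => h (congrArg Subtype.val e)
    simp [slots_set, Function.update_of_ne (h' _)]

/-- The values in the slots of a subset as a coordinate of the values in `I`. -/
def restrictSlots {J I : Finset (ℕ × ℕ)} (h : J ⊆ I) :
    Coordinate (SlotValues I) (SlotValues J) where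
  get i s := i ⟨s.1, h s.2⟩
  set i j s := if hs : s.1 ∈ J then j ⟨s.1, hs⟩ else i s
  get_set _ _ := by ext; simp
  set_get _ := by ext; simp
  set_set _ _ _ := by ext; simp; split_ifs <;> rfl

theorem restrictSlots_comp_slots {J I : Finset (ℕ × ℕ)} (h : J ⊆ I) :
    (restrictSlots h).comp (slots I) = slots J := by
  refine Coordinate.ext rfl (funext fun z => funext fun a => InfIndex.ext fun n k => ?_)
  simp only [Coordinate.comp_set, slots_set, restrictSlots]
  by_cases hJ : (n, k) ∈ J
  · simp [hJ, h hJ]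
  · simp [hJ]

/-! ### Matrix subalgebras of `A` -/

/-- The algebra `B`, as an algebra of operators on the Hilbert space with basis `UHFIndex`. -/
def uhfOperators : StarSubalgebra ℂ (Operators UHFIndex) := uhfSystem.alg

theorem amp_uhfSlot_mem (k : ℕ) (m : Matrix (BlockIndex (k + 1)) (BlockIndex (k + 1)) ℂ) :
    (uhfSlot k).amp m ∈ uhfOperators := by
  have h := RestrictedProd.amplify_amp (X := fun k => BlockIndex (k + 1))
    (fun _ => .inr (.inr ())) k (Coordinate.id _) m
  rw [uhfSlot, ← h]
  exact (SpatialSystem.tensorEmb (fun k => matrixSystem (k + 1)) k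
    (⟨(Coordinate.id (BlockIndex (k + 1))).amp m, trivial⟩ : (matrixSystem (k + 1)).alg)).2

/-- The algebra `A`, as an algebra of operators on the Hilbert space with basis `InfIndex`. -/
def infOperators : StarSubalgebra ℂ (Operators InfIndex) := infSystem.alg

/-- The action of `G` on the basis. -/
def infPerm : (ℕ → ZTwo) →* Equiv.Perm InfIndex := infSystem.perm

theorem amp_slot_mem (n k : ℕ) (m : Matrix (BlockIndex (k + 1)) (BlockIndex (k + 1)) ℂ) :
    (slot n k).amp m ∈ infOperators := by
  have h := RestrictedProd.amplify_amp (X := fun _ => UHFIndex)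
    (fun _ => RestrictedProd.base _) n (uhfSlot k) m
  rw [slot, ← h]
  exact (SpatialSystem.tensorEmb (fun _ => uhfSystem) n
    (⟨(uhfSlot k).amp m, amp_uhfSlot_mem k m⟩ : uhfSystem.alg)).2

theorem matrixUnit_slots_mem (I : Finset (ℕ × ℕ)) (i j : SlotValues I) :
    (slots I).matrixUnit i j ∈ infOperators := by
  induction I using Finset.induction_on with
  | empty =>
    suffices h : (slots ∅).matrixUnit i j = 1 from h ▸ one_mem infOperators
    ext f z
    have : (slots ∅).set z j = z := InfIndex.ext fun n k => by simp [slots_set]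
    simp only [Coordinate.matrixUnit_apply, this]
    rw [if_pos (Subsingleton.elim _ _)]
    rfl
  | insert s I hs ih =>
    have key : (slots (insert s I)).matrixUnit i j =
        (slot s.1 s.2).matrixUnit (i ⟨s, by simp⟩) (j ⟨s, by simp⟩) *
          (slots I).matrixUnit (fun t => i ⟨t.1, Finset.mem_insert_of_mem t.2⟩)
            (fun t => j ⟨t.1, Finset.mem_insert_of_mem t.2⟩) := by
      ext f z
      change _ = (slot s.1 s.2).matrixUnit (i ⟨s, by simp⟩) (j ⟨s, by simp⟩)
        ((slots I).matrixUnit (fun t => i ⟨t.1, Finset.mem_insert_of_mem t.2⟩)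
            (fun t => j ⟨t.1, Finset.mem_insert_of_mem t.2⟩) f) z
      simp only [Coordinate.matrixUnit_apply]
      have hget : (slots (insert s I)).get z = i ↔
          (slot s.1 s.2).get z = i ⟨s, by simp⟩ ∧
          (slots I).get ((slot s.1 s.2).set z (j ⟨s, by simp⟩)) =
            fun t : I => i ⟨t.1, Finset.mem_insert_of_mem t.2⟩ := by
        rw [funext_iff, funext_iff]
        constructor
        · intro h
          refine ⟨h ⟨s, by simp⟩, fun t => ?_⟩
          rw [slots_get, slot_set_of_ne _ _ _ _ _ _ fun e => hs (by
            rw [← show t.1 = s from e]; exact t.2)]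
          exact h ⟨t.1, by simp⟩
        · rintro ⟨h₁, h₂⟩ ⟨t, ht⟩
          by_cases hts : t = s
          · subst hts
            exact h₁
          · have hI : t ∈ I := Finset.mem_of_mem_insert_of_ne ht hts
            have := h₂ ⟨t, hI⟩
            rwa [slots_get, slot_set_of_ne _ _ _ _ _ _ hts] at this
      have hset : (slots (insert s I)).set z j =
          (slots I).set ((slot s.1 s.2).set z (j ⟨s, by simp⟩))
            fun t => j ⟨t.1, Finset.mem_insert_of_mem t.2⟩ := by
        refine InfIndex.ext fun n k => ?_
        rw [slots_set, slots_set]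
        by_cases hI : (n, k) ∈ I
        · simp [hI]
        · by_cases hts : (n, k) = s
          · subst hts
            simp [hI, slot_set_same]
          · simp [hI, hts, slot_set_of_ne _ _ _ _ _ _ hts]
      rw [hset]
      by_cases h₁ : (slot s.1 s.2).get z = i ⟨s, by simp⟩
      · by_cases h₂ : (slots I).get ((slot s.1 s.2).set z (j ⟨s, by simp⟩)) =
            fun t : I => i ⟨t.1, Finset.mem_insert_of_mem t.2⟩
        · rw [if_pos (hget.2 ⟨h₁, h₂⟩), if_pos h₁, if_pos h₂]
        · rw [if_neg fun h => h₂ (hget.1 h).2, if_pos h₁, if_neg h₂]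
      · rw [if_neg fun h => h₁ (hget.1 h).1, if_neg h₁]
    rw [key]
    refine mul_mem ?_ (ih _ _)
    rw [← Coordinate.amp_single]
    exact amp_slot_mem _ _ _

/-- A coordinate on which matrices act by elements of `A`. -/
def IsLocal {Y : Type} [DecidableEq Y] (c : Coordinate InfIndex Y) : Prop :=
  ∀ i j, c.matrixUnit i j ∈ infOperators

theorem isLocal_slots (I : Finset (ℕ × ℕ)) : IsLocal (slots I) := matrixUnit_slots_mem I

section Local

variable {Y W : Type} [DecidableEq Y] [DecidableEq W]

theorem isLocal_unit : IsLocal (Coordinate.unit InfIndex) := fun i j => by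
  suffices h : (Coordinate.unit InfIndex).matrixUnit i j = 1 from h ▸ one_mem infOperators
  ext f z
  change (if () = i then f z else 0) = f z
  exact if_pos rfl

theorem IsLocal.prod {c : Coordinate InfIndex Y} {d : Coordinate InfIndex W} (hc : IsLocal c)
    (hd : IsLocal d) (h : c.Indep d) : IsLocal (c.prod d h) := fun i j => by
  suffices h' : (c.prod d h).matrixUnit i j = c.matrixUnit i.1 j.1 * d.matrixUnit i.2 j.2 from
    h' ▸ mul_mem (hc i.1 j.1) (hd i.2 j.2)
  ext f z
  change _ = c.matrixUnit i.1 j.1 (d.matrixUnit i.2 j.2 f) z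
  simp only [Coordinate.matrixUnit_apply, Coordinate.prod_get, Coordinate.prod_set, h.get_right,
    ← ite_and, Prod.ext_iff, h.set_comm]

variable [Fintype Y] [Fintype W]

theorem IsLocal.amp_mem {c : Coordinate InfIndex Y} (hc : IsLocal c) (m : Matrix Y Y ℂ) :
    c.amp m ∈ infOperators := by
  rw [Coordinate.amp_eq_sum]
  exact sum_mem fun i _ => sum_mem fun j _ => infOperators.smul_mem (hc i j) _

/-- The embedding of a matrix algebra into `A` which is given by a local coordinate. -/
def IsLocal.emb {c : Coordinate InfIndex Y} (hc : IsLocal c) : Matrix Y Y ℂ →⋆ₐ[ℂ] InfAlg :=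
  (c.amp.codRestrict infOperators hc.amp_mem : Matrix Y Y ℂ →⋆ₐ[ℂ] infOperators)

theorem IsLocal.emb_val {c : Coordinate InfIndex Y} (hc : IsLocal c) (m : Matrix Y Y ℂ) :
    (hc.emb m).1 = c.amp m := rfl

theorem IsLocal.emb_injective {c : Coordinate InfIndex Y} (hc : IsLocal c) :
    Function.Injective hc.emb := by
  intro m n h
  have h' : c.amp m = c.amp n := congrArg Subtype.val h
  ext i j
  classical
  let z : InfIndex := c.set (RestrictedProd.base _) i
  have := congrArg (fun T : Operators InfIndex => T (lp.single 2 (c.set z j) (1 : ℂ)) z) h'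
  simp only [Coordinate.amp_apply] at this
  have hs (l : Y) : (lp.single 2 (c.set z j) (1 : ℂ) : EllTwo InfIndex) (c.set z l) =
      if l = j then 1 else 0 := by
    split_ifs with hl
    · rw [hl]; simp
    · rw [lp.single_apply_ne]
      intro e
      exact hl (by simpa using congrArg c.get e)
  simp only [hs] at this
  simpa [z] using this

theorem IsLocal.emb_prod_lift_fst {c : Coordinate InfIndex Y} {d : Coordinate InfIndex W}
    (hc : IsLocal c) (hd : IsLocal d) (h : c.Indep d) (m : Matrix Y Y ℂ) :
    (hc.prod hd h).emb ((Coordinate.fst Y W).lift m) = hc.emb m := by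
  refine Subtype.ext ?_
  rw [IsLocal.emb_val, IsLocal.emb_val, ← Coordinate.amp_comp, Coordinate.fst_comp_prod]

theorem IsLocal.emb_prod_lift_snd {c : Coordinate InfIndex Y} {d : Coordinate InfIndex W}
    (hc : IsLocal c) (hd : IsLocal d) (h : c.Indep d) (m : Matrix W W ℂ) :
    (hc.prod hd h).emb ((Coordinate.snd Y W).lift m) = hd.emb m := by
  refine Subtype.ext ?_
  rw [IsLocal.emb_val, IsLocal.emb_val, ← Coordinate.amp_comp, Coordinate.snd_comp_prod]

/-- The action of `G` on `Y` through `τ` is the one induced by the action on the basis. -/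
structure IsEquivariant (c : Coordinate InfIndex Y) (τ : (ℕ → ZTwo) →* Equiv.Perm Y) : Prop where
  get_perm : ∀ g z, c.get (infPerm g z) = τ g (c.get z)
  set_perm : ∀ g z i, c.set (infPerm g z) (τ g i) = infPerm g (c.set z i)

theorem IsEquivariant.infAction_emb {c : Coordinate InfIndex Y}
    {τ : (ℕ → ZTwo) →* Equiv.Perm Y} (h : IsEquivariant c τ) (hc : IsLocal c) (g : ℕ → ZTwo)
    (m : Matrix Y Y ℂ) :
    infAction g (hc.emb m) = hc.emb (m.submatrix (τ g⁻¹) (τ g⁻¹)) := by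
  refine Subtype.ext ?_
  rw [map_inv]
  exact c.permAd_amp (infPerm g) (τ g) (h.get_perm g) (h.set_perm g) m

end Local

theorem infPerm_apply (g : ℕ → ZTwo) (z : InfIndex) (n k : ℕ) :
    ((infPerm g z).1 n).1 k =
      ofInvolution (blockSwap (k + 1)) (blockSwap_sq _) (g n) ((z.1 n).1 k) := rfl

theorem isEquivariant_slots (I : Finset (ℕ × ℕ)) : IsEquivariant (slots I) (slotPerm I) where
  get_perm _ _ := rfl
  set_perm g z i := InfIndex.ext fun n k => by
    rw [infPerm_apply, slots_set, slots_set]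
    split_ifs <;> rfl

theorem isEquivariant_unit : IsEquivariant (Coordinate.unit InfIndex) 1 where
  get_perm _ _ := rfl
  set_perm _ _ _ := rfl

/-! ### Approximation of elements of `A` by matrices -/

/-- The slots `(n, k)` with `n, k < K`. -/
def box (K : ℕ) : Finset (ℕ × ℕ) := Finset.range K ×ˢ Finset.range K

@[simp] theorem mem_box {K : ℕ} {s : ℕ × ℕ} : s ∈ box K ↔ s.1 < K ∧ s.2 < K := by
  simp [box]

/-- The matrix algebra of the slots of `box K`, as an algebra of operators. -/
def boxOperators (K : ℕ) : StarSubalgebra ℂ (Operators InfIndex) := (slots (box K)).amp.range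

theorem boxOperators_mono : Monotone boxOperators := by
  rintro K L h _ ⟨m, rfl⟩
  have hb : box K ⊆ box L := fun s hs => by
    simp only [mem_box] at hs ⊢
    omega
  refine ⟨(restrictSlots hb).lift m, ?_⟩
  change (slots (box L)).amp ((restrictSlots hb).lift m) = (slots (box K)).amp m
  rw [← Coordinate.amp_comp, restrictSlots_comp_slots]

theorem amp_slot_mem_boxOperators (n k : ℕ)
    (m : Matrix (BlockIndex (k + 1)) (BlockIndex (k + 1)) ℂ) :
    (slot n k).amp m ∈ boxOperators (n + k + 1) := by
  let s : box (n + k + 1) := ⟨(n, k), by rw [mem_box]; constructor <;> dsimp only <;> omega⟩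
  refine ⟨(evalSlot s).lift m, ?_⟩
  change (slots (box (n + k + 1))).amp ((evalSlot s).lift m) = _
  rw [← Coordinate.amp_comp, evalSlot_comp_slots]

theorem SpatialSystem.tensorAlg_le {Γ : ℕ → Type} [∀ n, Group (Γ n)]
    (S : ∀ n, SpatialSystem (Γ n)) (U : StarSubalgebra ℂ (Operators (SpatialSystem.tensorIndex S)))
    (hU : IsClosed (U : Set (Operators (SpatialSystem.tensorIndex S))))
    (h : ∀ n, ∀ T ∈ (S n).alg, RestrictedProd.amplify (fun n => (S n).base) n T ∈ U) :
    SpatialSystem.tensorAlg S ≤ U := by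
  refine StarSubalgebra.topologicalClosure_minimal (iSup_le fun n => ?_) hU
  rintro _ ⟨T, hT, rfl⟩
  exact h n T hT

theorem uhfOperators_le : uhfOperators ≤
    (⨆ k, (uhfSlot k).amp.range : StarSubalgebra ℂ (Operators UHFIndex)).topologicalClosure := by
  have hcl := StarSubalgebra.isClosed_topologicalClosure
    (⨆ k, (uhfSlot k).amp.range : StarSubalgebra ℂ (Operators UHFIndex))
  refine SpatialSystem.tensorAlg_le (fun k => matrixSystem (k + 1)) _ hcl fun k T _ => ?_
  obtain ⟨m, hm⟩ := Coordinate.exists_amp_id_eq (Y := BlockIndex (k + 1)) T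
  have h := RestrictedProd.amplify_amp (X := fun k => BlockIndex (k + 1))
    (fun _ => .inr (.inr ())) k (Coordinate.id _) m
  have hmem : (uhfSlot k).amp m ∈ (⨆ k, (uhfSlot k).amp.range :
      StarSubalgebra ℂ (Operators UHFIndex)).topologicalClosure :=
    StarSubalgebra.le_topologicalClosure _ (le_iSup (fun k => (uhfSlot k).amp.range) k ⟨m, rfl⟩)
  rw [uhfSlot, ← h, hm] at hmem
  exact hmem

theorem infOperators_le : infOperators ≤ (⨆ K, boxOperators K).topologicalClosure := by
  have hcl := StarSubalgebra.isClosed_topologicalClosure (⨆ K, boxOperators K)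
  refine SpatialSystem.tensorAlg_le (fun _ => uhfSystem) _ hcl fun n T hT => ?_
  let e : Operators UHFIndex →⋆ₐ[ℂ] Operators InfIndex :=
    RestrictedProd.amplify (X := fun _ => UHFIndex) (fun _ => RestrictedProd.base _) n
  have he : Continuous e := map_continuous e
  have hle : uhfOperators ≤ (⨆ K, boxOperators K).topologicalClosure.comap e := by
    refine uhfOperators_le.trans (StarSubalgebra.topologicalClosure_minimal (iSup_le fun k => ?_)
      ((StarSubalgebra.isClosed_topologicalClosure _).preimage he))
    rintro _ ⟨m, rfl⟩
    refine StarSubalgebra.le_topologicalClosure _ (le_iSup boxOperators (n + k + 1) ?_)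
    have h : e ((uhfSlot k).amp m) = (slot n k).amp m :=
      RestrictedProd.amplify_amp (X := fun _ => UHFIndex) (fun _ => RestrictedProd.base _) n
        (uhfSlot k) m
    change e ((uhfSlot k).amp m) ∈ _
    rw [h]
    exact amp_slot_mem_boxOperators n k m
  exact hle hT

/-- The representation of `A` on the Hilbert space with basis `InfIndex`. -/
def infRep : InfAlg →⋆ₐ[ℂ] Operators InfIndex :=
  (infSystem.alg.subtype : infSystem.alg →⋆ₐ[ℂ] Operators infSystem.X)

theorem infRep_injective : Function.Injective infRep := Subtype.val_injective

theorem infRep_mem (a : InfAlg) : infRep a ∈ infOperators := a.2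

theorem norm_infRep (a : InfAlg) : ‖infRep a‖ = ‖a‖ := rfl

/-- The embedding into `A` of the matrix algebra of the slots of `box K`. -/
def boxEmb (K : ℕ) : Matrix (SlotValues (box K)) (SlotValues (box K)) ℂ →⋆ₐ[ℂ] InfAlg :=
  (isLocal_slots (box K)).emb

/-- The matrix algebras of the boxes exhaust `A` up to closure. -/
theorem exists_norm_sub_boxEmb_lt (a : InfAlg) {ε : ℝ} (hε : 0 < ε) :
    ∃ K₀, ∀ K ≥ K₀, ∃ m, ‖a - boxEmb K m‖ < ε := by
  have ha : infRep a ∈ closure (⋃ K, (boxOperators K : Set (Operators InfIndex))) := by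
    have h := SetLike.mem_coe.2 (infOperators_le (infRep_mem a))
    rwa [StarSubalgebra.topologicalClosure_coe,
      StarSubalgebra.coe_iSup_of_directed boxOperators_mono.directed_le] at h
  obtain ⟨T, hT, hlt⟩ := Metric.mem_closure_iff.1 ha ε hε
  obtain ⟨K₀, hK₀⟩ := Set.mem_iUnion.1 hT
  refine ⟨K₀, fun K hK => ?_⟩
  obtain ⟨m, hm⟩ := boxOperators_mono hK hK₀
  refine ⟨m, ?_⟩
  rw [← norm_infRep, map_sub, ← dist_eq_norm]
  rw [← hm] at hlt
  exact hlt

theorem not_finiteDimensional_infAlg : ¬ FiniteDimensional ℂ InfAlg := by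
  intro h
  let L := Module.finrank ℂ InfAlg
  have hle : Module.finrank ℂ (Matrix (SlotValues {(0, L)}) (SlotValues {(0, L)}) ℂ) ≤ L :=
    LinearMap.finrank_le_finrank_of_injective
      (f := (isLocal_slots {(0, L)}).emb.toAlgHom.toLinearMap)
      (isLocal_slots {(0, L)}).emb_injective
  rw [Module.finrank_matrix, Module.finrank_self, mul_one, Fintype.card_pi] at hle
  simp only [card_blockIndex] at hle
  have hc : ∏ s : ({(0, L)} : Finset (ℕ × ℕ)), 3 ^ (s.1.2 + 1) = 3 ^ (L + 1) := by
    rw [Finset.prod_coe_sort {(0, L)} fun s : ℕ × ℕ => 3 ^ (s.2 + 1)]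
    simp
  rw [hc] at hle
  have h1 : L + 1 < 3 ^ (L + 1) := Nat.lt_pow_self (by norm_num)
  nlinarith

theorem separableSpace_infAlg : TopologicalSpace.SeparableSpace InfAlg := by
  rw [← TopologicalSpace.isSeparable_univ_iff]
  have hs : TopologicalSpace.IsSeparable (closure (⋃ K, Set.range (boxEmb K))) := by
    refine (TopologicalSpace.IsSeparable.iUnion fun K => ?_).closure
    let f : (SlotValues (box K) → SlotValues (box K) → ℂ) →ₗ[ℂ] InfAlg :=
      (boxEmb K).toAlgHom.toLinearMap
    exact TopologicalSpace.isSeparable_range (f := f) f.continuous_of_finiteDimensional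
  refine hs.mono fun a _ => Metric.mem_closure_iff.2 fun ε hε => ?_
  obtain ⟨K, hK⟩ := exists_norm_sub_boxEmb_lt a hε
  obtain ⟨m, hm⟩ := hK K le_rfl
  exact ⟨_, Set.mem_iUnion.2 ⟨K, m, rfl⟩, by rwa [dist_eq_norm]⟩

/-! ### The group and its finite quotients -/

/-- The homomorphism from `G` to `∏_{n < K} ℤ/2` given by the first `K` entries. -/
def truncHom (K : ℕ) : (ℕ → ZTwo) →* (Fin K → ZTwo) where
  toFun g n := g n
  map_one' := rfl
  map_mul' _ _ := rfl

/-- The embedding of `∏_{n < K} ℤ/2` into `G`. -/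
def extendHom (K : ℕ) : (Fin K → ZTwo) →* (ℕ → ZTwo) where
  toFun h n := if hn : n < K then h ⟨n, hn⟩ else 1
  map_one' := by ext; simp
  map_mul' _ _ := by
    funext n
    simp only [Pi.mul_apply]
    split_ifs <;> simp

@[simp] theorem truncHom_apply (K : ℕ) (g : ℕ → ZTwo) (n : Fin K) : truncHom K g n = g n := rfl

@[simp] theorem extendHom_apply (K : ℕ) (h : Fin K → ZTwo) {n : ℕ} (hn : n < K) :
    extendHom K h n = h ⟨n, hn⟩ := dif_pos hn

@[simp] theorem truncHom_extendHom (K : ℕ) (h : Fin K → ZTwo) :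
    truncHom K (extendHom K h) = h := by
  ext n; simp

/-- `G` acts on the slots in the first `K` copies of `B` through the first `K` entries. -/
theorem slotPerm_extendHom_truncHom {K : ℕ} {I : Finset (ℕ × ℕ)} (hI : ∀ s ∈ I, s.1 < K)
    (g : ℕ → ZTwo) : slotPerm I (extendHom K (truncHom K g)) = slotPerm I g := by
  ext i s : 2
  simp [hI s.1 s.2]

theorem continuous_truncHom (K : ℕ) : Continuous (truncHom K) :=
  continuous_pi fun n => continuous_apply (n : ℕ)

/-- A continuous function on `G` is approximated by functions of finitely many entries. -/
theorem exists_norm_sub_extendHom_lt (f : C(ℕ → ZTwo, ℂ)) {ε : ℝ} (hε : 0 < ε) :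
    ∃ K₀, ∀ K ≥ K₀, ∀ g, ‖f g - f (extendHom K (truncHom K g))‖ < ε := by
  have hcyl (g : ℕ → ZTwo) : ∃ K, ∀ h : ℕ → ZTwo, (∀ n < K, h n = g n) →
      ‖f h - f g‖ < ε / 2 := by
    have ho : IsOpen {h | ‖f h - f g‖ < ε / 2} :=
      isOpen_lt (by fun_prop) continuous_const
    obtain ⟨I, u, hu, hsub⟩ := isOpen_pi_iff.1 ho g (by simpa using by linarith)
    refine ⟨I.sup id + 1, fun h hh => hsub fun n hn => ?_⟩
    rw [hh n (Nat.lt_succ_of_le (Finset.le_sup (f := id) hn))]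
    exact (hu n hn).2
  choose N hN using hcyl
  have hopen (g : ℕ → ZTwo) : IsOpen {h | truncHom (N g) h = truncHom (N g) g} :=
    (isOpen_discrete {truncHom (N g) g}).preimage (continuous_truncHom (N g))
  obtain ⟨t, ht⟩ := isCompact_univ.elim_finite_subcover _ hopen
    fun g _ => Set.mem_iUnion.2 ⟨g, rfl⟩
  refine ⟨t.sup N, fun K hK g => ?_⟩
  obtain ⟨g₀, hg₀, hg⟩ : ∃ g₀ ∈ t, truncHom (N g₀) g = truncHom (N g₀) g₀ := by
    simpa using ht (Set.mem_univ g)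
  have hle : N g₀ ≤ K := (Finset.le_sup hg₀).trans hK
  have h₁ : ∀ n < N g₀, g n = g₀ n := fun n hn => congrFun hg ⟨n, hn⟩
  have h₂ : ∀ n < N g₀, extendHom K (truncHom K g) n = g₀ n := fun n hn => by
    rw [← h₁ n hn, extendHom_apply K _ (hn.trans_le hle)]
    rfl
  calc ‖f g - f (extendHom K (truncHom K g))‖
      = ‖(f g - f g₀) - (f (extendHom K (truncHom K g)) - f g₀)‖ := by congr 1; ring
    _ ≤ _ := norm_sub_le _ _
    _ < ε := by linarith [hN g₀ _ h₁, hN g₀ _ h₂]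

theorem norm_infAction (g : ℕ → ZTwo) (a : InfAlg) : ‖infAction g a‖ = ‖a‖ :=
  StarAlgEquiv.norm_map _ _

theorem continuous_infAction (a : InfAlg) : Continuous fun g => infAction g a := by
  refine continuous_iff_continuousAt.2 fun g => Metric.tendsto_nhds.2 fun ε hε => ?_
  obtain ⟨K, hK⟩ := exists_norm_sub_boxEmb_lt a (half_pos hε)
  obtain ⟨m, hm⟩ := hK K le_rfl
  have hU : {h | truncHom K h = truncHom K g} ∈ nhds g :=
    ((isOpen_discrete {truncHom K g}).preimage (continuous_truncHom K)).mem_nhds rfl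
  filter_upwards [hU] with h hh
  have hinv : infAction h (boxEmb K m) = infAction g (boxEmb K m) := by
    have hI : ∀ s ∈ box K, s.1 < K := fun s hs => (mem_box.1 hs).1
    have hperm : slotPerm (box K) h⁻¹ = slotPerm (box K) g⁻¹ := by
      rw [← slotPerm_extendHom_truncHom hI, map_inv (truncHom K),
        show truncHom K h = truncHom K g from hh, ← map_inv (truncHom K),
        slotPerm_extendHom_truncHom hI]
    rw [boxEmb, (isEquivariant_slots _).infAction_emb, (isEquivariant_slots _).infAction_emb, hperm]
  rw [dist_eq_norm]
  calc ‖infAction h a - infAction g a‖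
      = ‖infAction h (a - boxEmb K m) - infAction g (a - boxEmb K m)‖ := by
        rw [map_sub, map_sub, hinv, sub_sub_sub_cancel_right]
    _ ≤ ‖infAction h (a - boxEmb K m)‖ + ‖infAction g (a - boxEmb K m)‖ := norm_sub_le _ _
    _ < ε := by rw [norm_infAction, norm_infAction]; linarith

/-! ### Diagonal coefficients -/

open Classical in
/-- The diagonal matrix coefficient of an element of `A` at a basis vector. -/
def diagCoeff (z : InfIndex) (a : InfAlg) : ℂ :=
  infRep a (lp.single 2 z (1 : ℂ)) z

theorem diagCoeff_sub (z : InfIndex) (a b : InfAlg) :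
    diagCoeff z (a - b) = diagCoeff z a - diagCoeff z b := rfl

theorem norm_diagCoeff_le (z : InfIndex) (a : InfAlg) : ‖diagCoeff z a‖ ≤ ‖a‖ := by
  classical
  let T := infRep a
  calc ‖diagCoeff z a‖ ≤ ‖T (lp.single 2 z (1 : ℂ))‖ := lp.norm_apply_le_norm (by norm_num) _ _
    _ ≤ ‖T‖ * ‖(lp.single 2 z (1 : ℂ) : EllTwo InfIndex)‖ := T.le_opNorm _
    _ = ‖a‖ := by rw [lp.norm_single (by norm_num)]; simp; rfl

theorem IsLocal.diagCoeff_emb {Y : Type} [DecidableEq Y] [Fintype Y] {c : Coordinate InfIndex Y}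
    (hc : IsLocal c) (m : Matrix Y Y ℂ) (z : InfIndex) :
    diagCoeff z (hc.emb m) = m (c.get z) (c.get z) := by
  classical
  exact c.amp_single_apply_self m z

/-- Fixed points of the action have the same diagonal coefficients along orbits. -/
theorem diagCoeff_infPerm {a : InfAlg} {g : ℕ → ZTwo} (ha : infAction g a = a) (z : InfIndex) :
    diagCoeff (infPerm g z) a = diagCoeff z a := by
  classical
  let T := infRep a
  have h : EllTwo.permAd (infPerm g) T = T := congrArg Subtype.val ha
  change T (lp.single 2 (infPerm g z) (1 : ℂ)) (infPerm g z) = T (lp.single 2 z (1 : ℂ)) z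
  conv_lhs => rw [← h]
  rw [EllTwo.permAd_apply, Equiv.symm_apply_apply]
  refine congrArg (fun f => T f z) (lp.ext (funext fun w => ?_))
  change (lp.single 2 (infPerm g z) (1 : ℂ) : EllTwo InfIndex) (infPerm g w) = _
  by_cases hw : w = z
  · subst hw; simp
  · rw [lp.single_apply_ne _ _ _ hw, lp.single_apply_ne]
    simpa using hw

/-- A nonzero positive element has a positive diagonal coefficient. -/
theorem exists_diagCoeff_pos {a : InfAlg} (ha : 0 ≤ a) (h0 : a ≠ 0) :
    ∃ z, ∃ c : ℝ, 0 < c ∧ diagCoeff z a = c := by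
  classical
  obtain ⟨b, rfl⟩ := CStarAlgebra.nonneg_iff_eq_star_mul_self.1 ha
  let T := infRep b
  have hT : T ≠ 0 := fun h => h0 (by
    rw [show b = 0 from infRep_injective (by rw [map_zero]; exact h)]; simp)
  obtain ⟨z, hz⟩ : ∃ z, T (lp.single 2 z (1 : ℂ)) ≠ 0 := by
    by_contra! h
    refine hT (ContinuousLinearMap.ext fun f => ?_)
    have hf := (lp.hasSum_single (p := 2) (by norm_num) f).mapL T
    have h0 (z : InfIndex) : T (lp.single 2 z (f z)) = 0 := by
      have : (lp.single 2 z (f z) : EllTwo InfIndex) = f z • lp.single 2 z (1 : ℂ) := by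
        rw [← lp.single_smul]; simp
      rw [this, map_smul, h, smul_zero]
    simp only [h0] at hf
    exact hf.unique hasSum_zero
  refine ⟨z, ‖T (lp.single 2 z (1 : ℂ))‖ ^ 2, by positivity, ?_⟩
  have h1 : diagCoeff z (star b * b) =
      inner ℂ (lp.single 2 z (1 : ℂ) : EllTwo InfIndex) ((star T * T) (lp.single 2 z (1 : ℂ))) := by
    rw [lp.inner_single_left]
    simp
    rfl
  rw [h1, ContinuousLinearMap.star_eq_adjoint]
  change inner ℂ (lp.single 2 z (1 : ℂ) : EllTwo InfIndex)
    (ContinuousLinearMap.adjoint T (T (lp.single 2 z (1 : ℂ)))) = _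
  rw [ContinuousLinearMap.adjoint_inner_right, inner_self_eq_norm_sq_to_K]
  simp

/-! ### Exact Cuntz subequivalence from approximate relations -/

section CStar

variable {A : Type*} [CStarAlgebra A]

/-- If `b` is self-adjoint in the corner of a projection `q` and close to `q`, then conjugating by
`b^(-1/2)`, computed in the corner, turns `b` into `q`. -/
theorem exists_conj_eq_of_norm_sub_lt_one {q b : A} (hq : IsStarProjection q)
    (hb : IsSelfAdjoint b) (hqb : q * b = b) (hbq : b * q = b) (h : ‖b - q‖ < 1) :
    ∃ z, z * b * star z = q ∧ ∀ θ : A ≃⋆ₐ[ℂ] A, θ b = b → θ q = q → θ z = z := by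
  -- `d` is `b` in the corner and `1` in the complementary corner
  set d := b + (1 - q) with hd
  have hdsa : IsSelfAdjoint d := hb.add ((IsSelfAdjoint.one A).sub hq.isSelfAdjoint)
  have hqq : q * q = q := hq.isIdempotentElem
  have hspec : ∀ t ∈ spectrum ℝ d, 0 < t := fun t ht => by
    rcases subsingleton_or_nontrivial A with _ | _
    · simp [spectrum.of_subsingleton] at ht
    have h1 : t - 1 ∈ spectrum ℝ (d - 1) := by
      have := (spectrum.sub_singleton_eq d (1 : ℝ)).subset
        (Set.sub_mem_sub ht (Set.mem_singleton 1))
      simpa using this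
    have h2 := spectrum.norm_le_norm_of_mem h1
    have h3 : d - 1 = b - q := by rw [hd]; abel
    rw [h3, Real.norm_eq_abs] at h2
    linarith [neg_abs_le (t - 1)]
  have hcont : ContinuousOn (fun t : ℝ => (√t)⁻¹) (spectrum ℝ d) :=
    Real.continuous_sqrt.continuousOn.inv₀ fun t ht => (Real.sqrt_pos.2 (hspec t ht)).ne'
  have hzsa : IsSelfAdjoint (cfc (fun t : ℝ => (√t)⁻¹) d) := cfc_predicate _ _
  have hcomm : Commute d q := by
    rw [Commute, SemiconjBy, hd, add_mul, mul_add, hbq, hqb, sub_mul, mul_sub, one_mul, mul_one]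
  have hzq := hcomm.cfc_real (fun t : ℝ => (√t)⁻¹)
  have hzdz : cfc (fun t : ℝ => (√t)⁻¹) d * d * cfc (fun t : ℝ => (√t)⁻¹) d = 1 := by
    conv_lhs => enter [1, 2]; rw [← cfc_id' ℝ d]
    rw [← cfc_mul _ _ d hcont (continuousOn_id' _),
      ← cfc_mul (fun t : ℝ => (√t)⁻¹ * t) _ d (hcont.mul (continuousOn_id' _)) hcont,
      ← cfc_one ℝ d]
    refine cfc_congr fun t ht => ?_
    have ht' := hspec t ht
    have hs : √t * √t = t := Real.mul_self_sqrt ht'.le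
    have hs' := (Real.sqrt_pos.2 ht').ne'
    simp only [Pi.one_apply]
    field_simp
    nlinarith
  have hbd : b = d * q := by rw [hd, add_mul, sub_mul, one_mul, hqq, sub_self, add_zero, hbq]
  refine ⟨cfc (fun t : ℝ => (√t)⁻¹) d, ?_, fun θ hθb hθq => ?_⟩
  · rw [hzsa.star_eq, hbd, mul_assoc, mul_assoc, ← hzq.eq, ← mul_assoc, ← mul_assoc, hzdz, one_mul]
  · have hθd : θ d = d := by rw [hd, map_add, map_sub, map_one, hθb, hθq]
    rw [StarAlgHomClass.map_cfc θ _ d hcont (StarAlgEquiv.isometry θ).continuous hdsa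
      (by rwa [hθd]), hθd]

theorem mul_eq_self_of_star_mul_self {V q : A} (hq : IsStarProjection q) (hV : star V * V = q) :
    V * q = V := by
  have hqq : q * q = q := hq.isIdempotentElem
  have : star (V - V * q) * (V - V * q) = 0 := by
    rw [star_sub, star_mul, hq.isSelfAdjoint.star_eq]
    calc (star V - q * star V) * (V - V * q)
        = star V * V - (star V * V) * q - q * (star V * V) + q * (star V * V) * q := by
          noncomm_ring
      _ = 0 := by rw [hV, hqq, hqq]; abel
  exact (sub_eq_zero.1 (CStarRing.star_mul_self_eq_zero_iff _ |>.1 this)).symm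

/-- If `V* y' V` is a multiple of the projection `V* V` and `y` is close to `y'` relative to the
factor, then `V* V = v y v*` for some `v`, which can be chosen invariant under all automorphisms
that fix `y` and `V`. -/
theorem exists_conj_eq_star_mul_self {y y' V q : A} {c δ : ℝ} {μ : ℂ} (hy : IsSelfAdjoint y)
    (hq : IsStarProjection q) (hV : star V * V = q) (h : star V * y' * V = μ • q)
    (hδ : ‖y - y'‖ ≤ δ) (hμ : ‖μ - c‖ ≤ δ) (hc : 2 * δ < c) :
    ∃ v, v * y * star v = q ∧ ∀ θ : A ≃⋆ₐ[ℂ] A, θ y = y → θ V = V → θ v = v := by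
  have hδ0 : 0 ≤ δ := (norm_nonneg _).trans hδ
  have hc0 : 0 < c := by linarith
  have hVq := mul_eq_self_of_star_mul_self hq hV
  have hqV : q * star V = star V := by
    conv_rhs => rw [← hVq, star_mul, hq.isSelfAdjoint.star_eq]
  have hV1 : ‖V‖ ≤ 1 := by
    have h1 : ‖V‖ * ‖V‖ ≤ 1 := by
      rw [← CStarRing.norm_star_mul_self, hV]; exact hq.norm_le
    nlinarith [norm_nonneg V]
  have hbsa : IsSelfAdjoint ((c⁻¹ : ℂ) • (star V * y * V)) := by
    refine IsSelfAdjoint.smul ?_ (hy.conjugate' V)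
    rw [IsSelfAdjoint, star_inv₀]
    simp
  have hcn : ‖(c⁻¹ : ℂ)‖ = c⁻¹ := by rw [norm_inv, Complex.norm_real, Real.norm_of_nonneg hc0.le]
  have hnorm : ‖(c⁻¹ : ℂ) • (star V * y * V) - q‖ < 1 := by
    have e : (c⁻¹ : ℂ) • (star V * y * V) - q =
        (c⁻¹ : ℂ) • (star V * (y - y') * V + (μ - c) • q) := by
      have hc' : (c : ℂ) ≠ 0 := by exact_mod_cast hc0.ne'
      rw [mul_sub, sub_mul, h, sub_smul, sub_add_sub_cancel, smul_sub, smul_smul,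
        inv_mul_cancel₀ hc', one_smul]
    have h1 : ‖star V * (y - y') * V‖ ≤ δ := by
      calc ‖star V * (y - y') * V‖ ≤ ‖star V‖ * ‖y - y'‖ * ‖V‖ := norm_mul₃_le
        _ ≤ 1 * δ * 1 := by rw [norm_star]; gcongr
        _ = δ := by ring
    have h2 : ‖(μ - c) • q‖ ≤ δ := by
      calc ‖(μ - c) • q‖ ≤ ‖μ - c‖ * ‖q‖ := norm_smul_le _ _
        _ ≤ δ * 1 := by gcongr; exact hq.norm_le
        _ = δ := mul_one δ
    rw [e, norm_smul, hcn, inv_mul_lt_iff₀ hc0, mul_one]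
    linarith [norm_add_le (star V * (y - y') * V) ((μ - c) • q)]
  obtain ⟨z, hz, hinv⟩ := exists_conj_eq_of_norm_sub_lt_one hq hbsa
    (by rw [mul_smul_comm, ← mul_assoc, ← mul_assoc, hqV])
    (by rw [smul_mul_assoc, mul_assoc, hVq]) hnorm
  refine ⟨z * (((√c : ℝ) : ℂ)⁻¹ • star V), ?_, fun θ hθy hθV => ?_⟩
  · have hs : ((√c : ℝ) : ℂ)⁻¹ * ((√c : ℝ) : ℂ)⁻¹ = (c : ℂ)⁻¹ := by
      rw [← mul_inv, ← Complex.ofReal_mul, Real.mul_self_sqrt hc0.le]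
    calc z * (((√c : ℝ) : ℂ)⁻¹ • star V) * y * star (z * (((√c : ℝ) : ℂ)⁻¹ • star V))
        = z * ((((√c : ℝ) : ℂ)⁻¹ * ((√c : ℝ) : ℂ)⁻¹) • (star V * y * V)) * star z := by
          rw [star_mul, star_smul, star_star, star_inv₀, Complex.star_def, Complex.conj_ofReal]
          simp only [smul_mul_assoc, mul_smul_comm, smul_smul, mul_assoc]
      _ = q := by rw [hs, hz]
  · have hθq : θ q = q := by rw [← hV, map_mul, map_star, hθV]
    rw [map_mul, map_smul, map_star, hθV, hinv θ ?_ hθq]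
    rw [map_smul, map_mul, map_mul, map_star, hθV, hθy]

end CStar

/-! ### Equivariant partial isometries from free orbits -/

section Transfer

variable {H : Type} [Group H] {Y X : Type} [DecidableEq Y] [DecidableEq X]
  (a : H →* Equiv.Perm Y) (b : H →* Equiv.Perm X) (z : Y) (N : X → Prop) [DecidablePred N]
  (θ : Y × X → X)

/-- The `h`-translate of the map `(i, t) ↦ (z, θ (i, t))`. -/
def transferMap (h : H) (e : Y × X) : Y × X :=
  (a h z, b h (θ (a h⁻¹ e.1, b h⁻¹ e.2)))

/-- The matrix which maps the basis vector at `(i, t)` to the one at `transferMap h (i, t)` if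
`N t`, and to `0` otherwise. -/
def transferMatrix (h : H) : Matrix (Y × X) (Y × X) ℂ :=
  Matrix.of fun p e => if N e.2 ∧ p = transferMap a b z θ h e then 1 else 0

/-- The data for a transfer: `N` is invariant, and the values of `θ` at the points of `N` lie
outside `N` in distinct free orbits. -/
structure IsTransfer : Prop where
  invariant : ∀ h x, N (b h x) ↔ N x
  not_mem : ∀ e, N e.2 → ¬ N (θ e)
  free : ∀ h h' e e', N e.2 → N e'.2 → b h (θ e) = b h' (θ e') → h = h' ∧ e = e'

variable {a b z N θ}

theorem transferMatrix_submatrix (hT : IsTransfer b N θ) (g h : H) :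
    (transferMatrix a b z N θ h).submatrix (Prod.map (a g⁻¹) (b g⁻¹)) (Prod.map (a g⁻¹) (b g⁻¹)) =
      transferMatrix a b z N θ (g * h) := by
  ext p e
  simp only [transferMatrix, Matrix.submatrix_apply, Matrix.of_apply, Prod.map_snd, hT.invariant]
  refine if_congr (and_congr_right fun _ => ?_) rfl rfl
  simp only [transferMap, Prod.ext_iff, Prod.map_fst, Prod.map_snd, map_mul, mul_inv_rev,
    Equiv.Perm.mul_apply, map_inv, Equiv.Perm.inv_eq_iff_eq]

/-- The projection of `ℓ²(X)` onto the span of the basis vectors in `N`. -/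
def indicatorMatrix (N : X → Prop) [DecidablePred N] : Matrix X X ℂ :=
  Matrix.diagonal fun t => if N t then 1 else 0

theorem fst_lift_apply (m : Matrix Y Y ℂ) (e e' : Y × X) :
    (Coordinate.fst Y X).lift m e e' = if e'.2 = e.2 then m e.1 e'.1 else 0 := by
  simp [Coordinate.lift, Prod.ext_iff]

theorem lift_snd_indicatorMatrix_apply (e e' : Y × X) :
    (Coordinate.snd Y X).lift (indicatorMatrix N) e e' = if e = e' ∧ N e.2 then 1 else 0 := by
  simp only [Coordinate.lift, Matrix.of_apply, Coordinate.snd_get, Coordinate.snd_set,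
    indicatorMatrix, Matrix.diagonal_apply, Prod.ext_iff, and_true]
  by_cases h1 : e.1 = e'.1 <;> by_cases h2 : e.2 = e'.2 <;> by_cases h3 : N e.2 <;>
    simp [h1, h2, h3, eq_comm]

variable (a b z N θ) in
/-- The normalized sum of the translates of a transfer. -/
def averagedTransfer [Fintype H] : Matrix (Y × X) (Y × X) ℂ :=
  ((√(Fintype.card H : ℝ) : ℝ) : ℂ)⁻¹ • ∑ h, transferMatrix a b z N θ h

theorem averagedTransfer_submatrix [Fintype H] (hT : IsTransfer b N θ) (g : H) :
    (averagedTransfer a b z N θ).submatrix (Prod.map (a g⁻¹) (b g⁻¹))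
      (Prod.map (a g⁻¹) (b g⁻¹)) = averagedTransfer a b z N θ := by
  have : (∑ h, transferMatrix a b z N θ h).submatrix (Prod.map (a g⁻¹) (b g⁻¹))
      (Prod.map (a g⁻¹) (b g⁻¹)) = ∑ h, (transferMatrix a b z N θ h).submatrix
        (Prod.map (a g⁻¹) (b g⁻¹)) (Prod.map (a g⁻¹) (b g⁻¹)) := by
    ext p e
    simp [Matrix.sum_apply]
  change ((√(Fintype.card H : ℝ) : ℝ) : ℂ)⁻¹ • (∑ h, transferMatrix a b z N θ h).submatrix _ _ = _
  rw [this]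
  simp only [transferMatrix_submatrix hT]
  congr 1
  exact Equiv.sum_comp (Equiv.mulLeft g) (transferMatrix a b z N θ)

variable [Fintype Y] [Fintype X]

/-- The translates of a transfer for different `h` have orthogonal ranges, and they stay orthogonal
when a matrix `m ⊗ 1` is put in between, because `m ⊗ 1` does not move the second coordinate. -/
theorem star_transferMatrix_mul [DecidableEq H] (hT : IsTransfer b N θ) (m : Matrix Y Y ℂ)
    (h h' : H) :
    star (transferMatrix a b z N θ h) * (Coordinate.fst Y X).lift m *
      transferMatrix a b z N θ h' =
    if h = h' then m (a h z) (a h z) • (Coordinate.snd Y X).lift (indicatorMatrix N) else 0 := by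
  ext e e'
  have hL : (star (transferMatrix a b z N θ h) * (Coordinate.fst Y X).lift m *
      transferMatrix a b z N θ h') e e' = if N e.2 ∧ N e'.2 then
        (Coordinate.fst Y X).lift m (transferMap a b z θ h e) (transferMap a b z θ h' e')
        else 0 := by
    simp only [Matrix.mul_apply, Matrix.star_apply, transferMatrix, Matrix.of_apply]
    by_cases h1 : N e.2 <;> by_cases h2 : N e'.2 <;> simp [h1, h2]
  have hiff (h1 : N e.2) (h2 : N e'.2) :
      (transferMap a b z θ h' e').2 = (transferMap a b z θ h e).2 ↔ h = h' ∧ e = e' := by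
    constructor
    · intro heq
      obtain ⟨rfl, h4⟩ := hT.free h' h (a h'⁻¹ e'.1, b h'⁻¹ e'.2) (a h⁻¹ e.1, b h⁻¹ e.2)
        ((hT.invariant _ _).2 h2) ((hT.invariant _ _).2 h1) heq
      simp only [Prod.mk.injEq, EmbeddingLike.apply_eq_iff_eq] at h4
      exact ⟨rfl, (Prod.ext h4.1 h4.2).symm⟩
    · rintro ⟨rfl, rfl⟩
      rfl
  rw [hL]
  by_cases hh : h = h'
  · subst hh
    rw [if_pos rfl, Matrix.smul_apply, lift_snd_indicatorMatrix_apply, smul_eq_mul]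
    by_cases h1 : N e.2
    · by_cases h2 : N e'.2
      · by_cases he : e = e'
        · subst he
          simp [h1, fst_lift_apply, transferMap]
        · rw [if_pos ⟨h1, h2⟩, fst_lift_apply, if_neg fun h3 => he ((hiff h1 h2).1 h3).2,
            if_neg fun h3 => he h3.1, mul_zero]
      · rw [if_neg fun h3 => h2 h3.2, if_neg, mul_zero]
        rintro ⟨rfl, h3⟩
        exact h2 h3
    · rw [if_neg fun h3 => h1 h3.1, if_neg fun h3 => h1 h3.2, mul_zero]
  · rw [if_neg hh, Matrix.zero_apply]
    by_cases h1 : N e.2 ∧ N e'.2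
    · rw [if_pos h1, fst_lift_apply, if_neg fun h3 => hh ((hiff h1.1 h1.2).1 h3).1]
    · rw [if_neg h1]

theorem indicatorMatrix_mul_transferMatrix (hT : IsTransfer b N θ) (h : H) :
    (Coordinate.snd Y X).lift (indicatorMatrix N) * transferMatrix a b z N θ h = 0 := by
  ext p e
  rw [Matrix.mul_apply, Matrix.zero_apply]
  refine Finset.sum_eq_zero fun q _ => ?_
  simp only [transferMatrix, Matrix.of_apply, Coordinate.lift, indicatorMatrix,
    Matrix.diagonal_apply, Coordinate.snd_get]
  by_cases h1 : N e.2 ∧ q = transferMap a b z θ h e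
  · have h2 : ¬ N q.2 := by
      rw [h1.2, transferMap, hT.invariant]
      exact hT.not_mem _ ((hT.invariant _ _).2 h1.1)
    by_cases h3 : p.2 = q.2 <;> simp [h3, h2]
  · simp [h1]

theorem star_averagedTransfer_mul [Fintype H] (hT : IsTransfer b N θ) (m : Matrix Y Y ℂ) :
    star (averagedTransfer a b z N θ) * (Coordinate.fst Y X).lift m *
      averagedTransfer a b z N θ =
    ((Fintype.card H : ℂ)⁻¹ * ∑ h, m (a h z) (a h z)) •
      (Coordinate.snd Y X).lift (indicatorMatrix N) := by
  classical
  have hs : ((√(Fintype.card H : ℝ) : ℝ) : ℂ)⁻¹ * ((√(Fintype.card H : ℝ) : ℝ) : ℂ)⁻¹ =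
      (Fintype.card H : ℂ)⁻¹ := by
    rw [← mul_inv, ← Complex.ofReal_mul, Real.mul_self_sqrt (Nat.cast_nonneg _)]
    simp
  rw [averagedTransfer, star_smul, star_inv₀, Complex.star_def, Complex.conj_ofReal]
  rw [smul_mul_assoc, smul_mul_assoc, mul_smul_comm, smul_smul, hs, mul_smul, star_sum,
    Finset.sum_mul, Finset.sum_mul, Finset.sum_smul]
  congr 1
  refine Finset.sum_congr rfl fun h _ => ?_
  rw [Finset.mul_sum, Finset.sum_congr rfl fun h' _ => star_transferMatrix_mul hT m h h']
  simp

theorem indicatorMatrix_mul_averagedTransfer [Fintype H] (hT : IsTransfer b N θ) :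
    (Coordinate.snd Y X).lift (indicatorMatrix N) * averagedTransfer a b z N θ = 0 := by
  rw [averagedTransfer, mul_smul_comm, Finset.mul_sum,
    Finset.sum_eq_zero fun h _ => indicatorMatrix_mul_transferMatrix hT h, smul_zero]

end Transfer

/-! ### Free orbits in the basis of `⊗ M_{3 ^ L}` -/

/-- The slots `(n, L)` with `n < K`. -/
def column (K L : ℕ) : Finset (ℕ × ℕ) := Finset.range K ×ˢ {L}

@[simp] theorem mem_column {K L : ℕ} {s : ℕ × ℕ} : s ∈ column K L ↔ s.1 < K ∧ s.2 = L := by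
  rw [column, Finset.mem_product, Finset.mem_range, Finset.mem_singleton]

theorem disjoint_box_column {K L : ℕ} (h : K ≤ L) : Disjoint (box K) (column K L) := by
  refine Finset.disjoint_left.2 fun s hs hs' => ?_
  rw [mem_box] at hs
  rw [mem_column] at hs'
  omega

/-- Some value is the last basis vector, which is fixed by the action. These are the basis vectors
whose orbits are not free. -/
abbrev HasFixedSlot {I : Finset (ℕ × ℕ)} (t : SlotValues I) : Prop :=
  ∃ s, t s = .inr (.inr ())

theorem eq_one_or_eq_generator (g : ZTwo) : g = 1 ∨ g = Multiplicative.ofAdd 1 := by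
  revert g; decide

theorem ofInvolution_generator {P : Type} [Group P] (w : P) (hw : w ^ 2 = 1) :
    ofInvolution w hw (Multiplicative.ofAdd 1) = w := pow_one w

theorem hasFixedSlot_slotPerm {I : Finset (ℕ × ℕ)} (g : ℕ → ZTwo) (t : SlotValues I) :
    HasFixedSlot (slotPerm I g t) ↔ HasFixedSlot t := by
  refine exists_congr fun s => ?_
  rw [slotPerm_apply]
  conv_lhs => rw [← ofInvolution_blockSwap_base (s.1.2 + 1) (g s.1.1)]
  exact (ofInvolution (blockSwap (s.1.2 + 1)) (blockSwap_sq _) (g s.1.1)).injective.eq_iff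

/-- The block containing a basis vector, as an element of `ℤ/2`. (The last basis vector is assigned
to the second block.) -/
def blockOf {k : ℕ} : BlockIndex k → ZTwo
  | .inl _ => 1
  | .inr _ => Multiplicative.ofAdd 1

theorem blockOf_ofInvolution {k : ℕ} (g : ZTwo) {b : BlockIndex k} (hb : b ≠ .inr (.inr ())) :
    blockOf (ofInvolution (blockSwap k) (blockSwap_sq k) g b) = g * blockOf b := by
  rcases eq_one_or_eq_generator g with rfl | rfl
  · simp
  · rw [ofInvolution_generator]
    rcases b with i | i | u
    · rfl
    · exact (by decide : (1 : ZTwo) = Multiplicative.ofAdd 1 * Multiplicative.ofAdd 1)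
    · exact absurd rfl hb

/-- The element of `∏_{n < K} ℤ/2` given by the blocks of the values in `column K L`. -/
def columnBlocks {K L : ℕ} (t : SlotValues (column K L)) : Fin K → ZTwo :=
  fun n => blockOf (t ⟨(n, L), by simp⟩)

theorem columnBlocks_slotPerm {K L : ℕ} (g : ℕ → ZTwo) {t : SlotValues (column K L)}
    (ht : ¬ HasFixedSlot t) :
    columnBlocks (slotPerm _ g t) = truncHom K g * columnBlocks t := by
  ext n : 1
  exact blockOf_ofInvolution _ fun h => ht ⟨_, h⟩

/-- The values in the first blocks. They represent distinct free orbits. -/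
def firstBlock {I : Finset (ℕ × ℕ)} (a : (s : I) → Fin (blockSize (s.1.2 + 1))) : SlotValues I :=
  fun s => .inl (a s)

theorem not_hasFixedSlot_firstBlock {I : Finset (ℕ × ℕ)}
    (a : (s : I) → Fin (blockSize (s.1.2 + 1))) : ¬ HasFixedSlot (firstBlock a) := by
  simp [HasFixedSlot, firstBlock]

theorem slotPerm_firstBlock_eq {K L : ℕ} {h h' : Fin K → ZTwo}
    {a a' : (s : column K L) → Fin (blockSize (s.1.2 + 1))}
    (heq : slotPerm (column K L) (extendHom K h) (firstBlock a) =
      slotPerm (column K L) (extendHom K h') (firstBlock a')) : h = h' ∧ a = a' := by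
  have h1 : h = h' := by
    have := congrArg columnBlocks heq
    rw [columnBlocks_slotPerm _ (not_hasFixedSlot_firstBlock a),
      columnBlocks_slotPerm _ (not_hasFixedSlot_firstBlock a')] at this
    have h2 (a : (s : column K L) → Fin (blockSize (s.1.2 + 1))) :
        columnBlocks (firstBlock a) = 1 := rfl
    simpa [h2] using this
  refine ⟨h1, funext fun s => ?_⟩
  rw [h1, EmbeddingLike.apply_eq_iff_eq] at heq
  exact Sum.inl_injective (congrFun heq s)

theorem two_mul_blockSize_add_one (k : ℕ) : 2 * blockSize k + 1 = 3 ^ k := by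
  rw [← card_blockIndex k]
  simp only [Fintype.card_sum, Fintype.card_fin, Fintype.card_unit]
  ring

theorem card_slotValues_column (K L : ℕ) :
    Fintype.card (SlotValues (column K L)) = (3 ^ (L + 1)) ^ K := by
  rw [Fintype.card_pi]
  simp only [card_blockIndex]
  rw [Finset.prod_coe_sort (column K L) fun s : ℕ × ℕ => 3 ^ (s.2 + 1), column,
    Finset.prod_product]
  simp

theorem card_firstBlock_column (K L : ℕ) :
    Fintype.card ((s : column K L) → Fin (blockSize (s.1.2 + 1))) = blockSize (L + 1) ^ K := by
  rw [Fintype.card_pi]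
  simp only [Fintype.card_fin]
  rw [Finset.prod_coe_sort (column K L) fun s : ℕ × ℕ => blockSize (s.2 + 1), column,
    Finset.prod_product]
  simp

theorem card_not_hasFixedSlot_column (K L : ℕ) :
    Fintype.card {t : SlotValues (column K L) // ¬ HasFixedSlot t} = (3 ^ (L + 1) - 1) ^ K := by
  have e : {t : SlotValues (column K L) // ¬ HasFixedSlot t} ≃
      ((s : column K L) → {b : BlockIndex (s.1.2 + 1) // b ≠ .inr (.inr ())}) :=
    (Equiv.subtypeEquivRight fun t => by simp [HasFixedSlot]).trans
      (Equiv.subtypePiEquivPi (p := fun (s : column K L) (b : BlockIndex (s.1.2 + 1)) =>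
        b ≠ .inr (.inr ())))
  rw [Fintype.card_congr e, Fintype.card_pi]
  have h (s : column K L) : Fintype.card {b : BlockIndex (s.1.2 + 1) // b ≠ .inr (.inr ())} =
      3 ^ (s.1.2 + 1) - 1 := by
    rw [Fintype.card_subtype_compl, card_blockIndex, Fintype.card_subtype_eq]
  simp only [h]
  rw [Finset.prod_coe_sort (column K L) fun s : ℕ × ℕ => 3 ^ (s.2 + 1) - 1, column,
    Finset.prod_product]
  simp

/-- Basis vectors with a fixed slot are rare: a fixed multiple of their number is at most the number
of basis vectors in the first blocks, in all columns `L` that are far out. -/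
theorem exists_card_hasFixedSlot_le (K M : ℕ) : ∃ L ≥ K,
    M * Fintype.card {t : SlotValues (column K L) // HasFixedSlot t} ≤
      Fintype.card ((s : column K L) → Fin (blockSize (s.1.2 + 1))) := by
  refine ⟨K + M * K * 3 ^ K, Nat.le_add_right _ _, ?_⟩
  set L := K + M * K * 3 ^ K with hL
  obtain ⟨T, hT⟩ : ∃ T, T = 3 ^ (L + 1) := ⟨_, rfl⟩
  set r := blockSize (L + 1) with hr
  have hrT : 2 * r + 1 = T := (two_mul_blockSize_add_one (L + 1)).trans hT.symm
  have hTL : M * K * 3 ^ K ≤ T := by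
    have : L + 1 < 3 ^ (L + 1) := Nat.lt_pow_self (by norm_num)
    omega
  have hT1 : 3 ≤ T := by
    rw [hT, pow_succ]
    have := Nat.one_le_pow L 3 (by norm_num)
    omega
  have hcard := Fintype.card_subtype_compl (fun t : SlotValues (column K L) => HasFixedSlot t)
  have hle := Fintype.card_subtype_le (fun t : SlotValues (column K L) => HasFixedSlot t)
  rw [card_not_hasFixedSlot_column, card_slotValues_column] at hcard
  rw [card_slotValues_column] at hle
  rw [card_firstBlock_column, ← hr]
  rw [← hT] at hcard hle
  set n := Fintype.card {t : SlotValues (column K L) // HasFixedSlot t}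
  have hT0 : (0 : ℝ) < T := by exact_mod_cast (by omega : 0 < T)
  have hn : (n : ℝ) = (T : ℝ) ^ K - ((T : ℝ) - 1) ^ K := by
    have h1 : n = T ^ K - (T - 1) ^ K := by omega
    have h2 : (T - 1) ^ K ≤ T ^ K := Nat.pow_le_pow_left (Nat.sub_le _ _) _
    rw [h1, Nat.cast_sub h2, Nat.cast_pow, Nat.cast_pow, Nat.cast_sub (by omega)]
    simp
  -- Bernoulli's inequality
  have hB : (n : ℝ) * T ≤ K * (T : ℝ) ^ K := by
    have hb := one_add_mul_le_pow (a := -(1 / (T : ℝ))) (by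
      rw [neg_le_neg_iff, div_le_iff₀ hT0]
      have : (3 : ℝ) ≤ T := by exact_mod_cast hT1
      linarith) K
    have h1 : ((T : ℝ) - 1) ^ K = (T : ℝ) ^ K * (1 + -(1 / (T : ℝ))) ^ K := by
      rw [← mul_pow]
      congr 1
      field_simp
      ring
    have h2 : (T : ℝ) ^ K * (1 + K * -(1 / (T : ℝ))) ≤ ((T : ℝ) - 1) ^ K := by
      rw [h1]
      exact mul_le_mul_of_nonneg_left hb (by positivity)
    have h3 : (T : ℝ) ^ K * (1 + K * -(1 / (T : ℝ))) * T = (T : ℝ) ^ K * T - K * (T : ℝ) ^ K := by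
      field_simp
      ring
    rw [hn, sub_mul]
    nlinarith
  have hr3 : (T : ℝ) ^ K ≤ 3 ^ K * (r : ℝ) ^ K := by
    rw [← mul_pow]
    refine pow_le_pow_left₀ hT0.le ?_ K
    exact_mod_cast (by omega : T ≤ 3 * r)
  have hTL' : (M : ℝ) * K * 3 ^ K ≤ T := by exact_mod_cast hTL
  have hfin : (M : ℝ) * n * T ≤ (r : ℝ) ^ K * T := by
    calc (M : ℝ) * n * T = M * (n * T) := by ring
      _ ≤ M * (K * (T : ℝ) ^ K) := by gcongr
      _ ≤ M * (K * (3 ^ K * (r : ℝ) ^ K)) := by gcongr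
      _ = (M : ℝ) * K * 3 ^ K * (r : ℝ) ^ K := by ring
      _ ≤ T * (r : ℝ) ^ K := by gcongr
      _ = (r : ℝ) ^ K * T := mul_comm _ _
  exact_mod_cast le_of_mul_le_mul_right hfin hT0

/-- The action of `∏_{n < K} ℤ/2` on the values in the slots of `I`. -/
def finSlotPerm (K : ℕ) (I : Finset (ℕ × ℕ)) : (Fin K → ZTwo) →* Equiv.Perm (SlotValues I) :=
  (slotPerm I).comp (extendHom K)

theorem finSlotPerm_truncHom {K : ℕ} {I : Finset (ℕ × ℕ)} (hI : ∀ s ∈ I, s.1 < K)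
    (g : ℕ → ZTwo) : finSlotPerm K I (truncHom K g) = slotPerm I g :=
  slotPerm_extendHom_truncHom hI g

/-- Pairs with a non-free second entry can be assigned to free orbits injectively, if the column is
far out. -/
theorem exists_isTransfer (K : ℕ) (Y : Type) [Fintype Y] :
    ∃ L ≥ K, ∃ θ : Y × SlotValues (column K L) → SlotValues (column K L),
      IsTransfer (finSlotPerm K (column K L)) HasFixedSlot θ := by
  classical
  obtain ⟨L, hL, hcard⟩ := exists_card_hasFixedSlot_le K (Fintype.card Y)
  rw [← Fintype.card_prod] at hcard
  obtain ⟨f⟩ := Function.Embedding.nonempty_of_card_le hcard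
  have hθ (e : Y × SlotValues (column K L)) (he : HasFixedSlot e.2) :
      (if h : HasFixedSlot e.2 then firstBlock (f (e.1, ⟨e.2, h⟩)) else e.2) =
        firstBlock (f (e.1, ⟨e.2, he⟩)) := dif_pos he
  refine ⟨L, hL, fun e => if h : HasFixedSlot e.2 then firstBlock (f (e.1, ⟨e.2, h⟩)) else e.2,
    fun h t => hasFixedSlot_slotPerm _ t, fun e he => ?_, fun h h' e e' he he' heq => ?_⟩
  · rw [hθ e he]
    exact not_hasFixedSlot_firstBlock _
  · rw [hθ e he, hθ e' he'] at heq
    obtain ⟨h1, h2⟩ := slotPerm_firstBlock_eq heq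
    refine ⟨h1, ?_⟩
    have h3 := f.injective h2
    simp only [Prod.mk.injEq, Subtype.mk.injEq] at h3
    exact Prod.ext h3.1 h3.2

theorem IsTransfer.comp_left {H Y Y' X : Type} [Group H] {b : H →* Equiv.Perm X} {N : X → Prop}
    {θ : Y × X → X} (hT : IsTransfer b N θ) {f : Y' → Y} (hf : Function.Injective f) :
    IsTransfer b N fun e : Y' × X => θ (f e.1, e.2) where
  invariant := hT.invariant
  not_mem e he := hT.not_mem (f e.1, e.2) he
  free h h' e e' he he' heq := by
    obtain ⟨h1, h2⟩ := hT.free h h' (f e.1, e.2) (f e'.1, e'.2) he he' heq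
    rw [Prod.mk.injEq] at h2
    exact ⟨h1, Prod.ext (hf h2.1) h2.2⟩

/-! ### Transfers in `A` -/

theorem Coordinate.fst_lift_mul_snd_lift {Y X : Type} [DecidableEq Y] [DecidableEq X] [Fintype Y]
    [Fintype X] (m : Matrix Y Y ℂ) (n : Matrix X X ℂ) (e e' : Y × X) :
    ((Coordinate.fst Y X).lift m * (Coordinate.snd Y X).lift n) e e' =
      m e.1 e'.1 * n e.2 e'.2 := by
  rw [Matrix.mul_apply, Finset.sum_eq_single (e'.1, e.2)]
  · simp [Coordinate.lift]
  · rintro q - hq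
    by_cases h1 : q.2 = e.2
    · have h2 : e'.1 ≠ q.1 := fun h2 => hq (Prod.ext h2.symm h1)
      simp [Coordinate.lift, Prod.ext_iff, h2]
    · simp [Coordinate.lift, Prod.ext_iff, h1]
  · simp

theorem Coordinate.snd_lift_mul_fst_lift {Y X : Type} [DecidableEq Y] [DecidableEq X] [Fintype Y]
    [Fintype X] (m : Matrix Y Y ℂ) (n : Matrix X X ℂ) (e e' : Y × X) :
    ((Coordinate.snd Y X).lift n * (Coordinate.fst Y X).lift m) e e' =
      m e.1 e'.1 * n e.2 e'.2 := by
  rw [Matrix.mul_apply, Finset.sum_eq_single (e.1, e'.2)]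
  · simp [Coordinate.lift, mul_comm]
  · rintro q - hq
    by_cases h1 : q.1 = e.1
    · have h2 : e'.2 ≠ q.2 := fun h2 => hq (Prod.ext h1 h2.symm)
      simp [Coordinate.lift, Prod.ext_iff, h2]
    · simp [Coordinate.lift, Prod.ext_iff, h1]
  · simp

/-- Matrices acting in independent coordinates commute. -/
theorem IsLocal.commute_emb {Y X : Type} [DecidableEq Y] [DecidableEq X] [Fintype Y] [Fintype X]
    {c : Coordinate InfIndex Y} {d : Coordinate InfIndex X} (hc : IsLocal c) (hd : IsLocal d)
    (h : c.Indep d) (m : Matrix Y Y ℂ) (n : Matrix X X ℂ) :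
    Commute (hc.emb m) (hd.emb n) := by
  rw [← hc.emb_prod_lift_fst hd h, ← hc.emb_prod_lift_snd hd h, Commute, SemiconjBy, ← map_mul,
    ← map_mul]
  congr 1
  ext e e'
  rw [Coordinate.fst_lift_mul_snd_lift, Coordinate.snd_lift_mul_fst_lift]

/-- The diagonal action of a group on a product, given by actions on the factors. -/
@[simps] def permProd {H Y X : Type} [Group H] (a : H →* Equiv.Perm Y) (b : H →* Equiv.Perm X) :
    H →* Equiv.Perm (Y × X) where
  toFun h := Equiv.prodCongr (a h) (b h)
  map_one' := by ext <;> simp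
  map_mul' _ _ := by ext <;> simp

theorem IsEquivariant.prod {Y X : Type} {c : Coordinate InfIndex Y} {d : Coordinate InfIndex X}
    {τ : (ℕ → ZTwo) →* Equiv.Perm Y} {σ : (ℕ → ZTwo) →* Equiv.Perm X} (hc : IsEquivariant c τ)
    (hd : IsEquivariant d σ) (h : c.Indep d) : IsEquivariant (c.prod d h) (permProd τ σ) where
  get_perm g z := Prod.ext (hc.get_perm g z) (hd.get_perm g z)
  set_perm g z i := by
    simp [Coordinate.prod, hc.set_perm, hd.set_perm]

theorem isEquivariant_slots_truncHom {K : ℕ} {I : Finset (ℕ × ℕ)} (hI : ∀ s ∈ I, s.1 < K) :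
    IsEquivariant (slots I) ((finSlotPerm K I).comp (truncHom K)) := by
  have : (finSlotPerm K I).comp (truncHom K) = slotPerm I :=
    MonoidHom.ext fun g => finSlotPerm_truncHom hI g
  rw [this]
  exact isEquivariant_slots I

theorem isEquivariant_column (K L : ℕ) :
    IsEquivariant (slots (column K L)) ((finSlotPerm K (column K L)).comp (truncHom K)) :=
  isEquivariant_slots_truncHom fun _ hs => (mem_column.1 hs).1

/-- Functions on `Y` as diagonal matrices in `A`. -/
def IsLocal.diagEmb {Y : Type} [DecidableEq Y] [Fintype Y] {c : Coordinate InfIndex Y}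
    (hc : IsLocal c) : (Y → ℂ) →⋆ₐ[ℂ] InfAlg where
  toFun d := hc.emb (Matrix.diagonal d)
  map_one' := by rw [Matrix.diagonal_one', map_one]
  map_mul' d d' := by rw [← map_mul, Matrix.diagonal_mul_diagonal]; rfl
  map_zero' := by rw [Matrix.diagonal_zero', map_zero]
  map_add' d d' := by rw [← map_add, Matrix.diagonal_add]; rfl
  commutes' r := by
    rw [← hc.emb.toAlgHom.commutes r]
    rfl
  map_star' d := by
    rw [← map_star, Matrix.star_eq_conjTranspose, Matrix.diagonal_conjTranspose]

theorem IsLocal.diagEmb_apply {Y : Type} [DecidableEq Y] [Fintype Y] {c : Coordinate InfIndex Y}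
    (hc : IsLocal c) (d : Y → ℂ) : hc.diagEmb d = hc.emb (Matrix.diagonal d) := rfl

theorem IsEquivariant.infAction_diagEmb {Y : Type} [DecidableEq Y] [Fintype Y]
    {c : Coordinate InfIndex Y} {τ : (ℕ → ZTwo) →* Equiv.Perm Y} (h : IsEquivariant c τ)
    (hc : IsLocal c) (g : ℕ → ZTwo) (d : Y → ℂ) :
    infAction g (hc.diagEmb d) = hc.diagEmb fun i => d (τ g⁻¹ i) := by
  rw [hc.diagEmb_apply, h.infAction_emb, Matrix.submatrix_diagonal_equiv]
  rfl

theorem IsLocal.isStarProjection_diagEmb {Y : Type} [DecidableEq Y] [Fintype Y]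
    {c : Coordinate InfIndex Y} (hc : IsLocal c) {d : Y → ℂ} (hd : ∀ i, d i = 0 ∨ d i = 1) :
    IsStarProjection (hc.diagEmb d) := by
  refine ⟨?_, ?_⟩
  · rw [IsIdempotentElem, ← map_mul]
    congr 1
    ext i
    rcases hd i with h | h <;> simp [h]
  · rw [IsSelfAdjoint, ← map_star]
    congr 1
    ext i
    rcases hd i with h | h <;> simp [h]

/-- The embedding into `A` of the matrix algebra of the slots of `column K L`. -/
def columnEmb (K L : ℕ) :
    Matrix (SlotValues (column K L)) (SlotValues (column K L)) ℂ →⋆ₐ[ℂ] InfAlg :=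
  (isLocal_slots (column K L)).emb

/-- The projection onto the basis vectors whose orbits under `∏_{n < K} ℤ/2` in `column K L` are not
free. -/
def nonfreeProj (K L : ℕ) : InfAlg := columnEmb K L (indicatorMatrix HasFixedSlot)

theorem nonfreeProj_eq_diagEmb (K L : ℕ) : nonfreeProj K L =
    (isLocal_slots (column K L)).diagEmb fun t => if HasFixedSlot t then 1 else 0 := rfl

theorem isStarProjection_nonfreeProj (K L : ℕ) : IsStarProjection (nonfreeProj K L) :=
  (isLocal_slots _).isStarProjection_diagEmb fun t => by by_cases h : HasFixedSlot t <;> simp [h]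

section

variable {K L : ℕ} {Y : Type} [DecidableEq Y] [Fintype Y] {c : Coordinate InfIndex Y}
  (hc : IsLocal c) (hi : c.Indep (slots (column K L))) {a : (Fin K → ZTwo) →* Equiv.Perm Y}
  {z : Y} {θ : Y × SlotValues (column K L) → SlotValues (column K L)}

variable (a z θ) in
/-- The transfer, as an element of `A`. -/
def transfer : InfAlg :=
  (hc.prod (isLocal_slots _) hi).emb
    (transferMatrix a (finSlotPerm K (column K L)) z HasFixedSlot θ 1)

variable (a z θ) in
/-- The normalized sum of the translates of a transfer, as an element of `A`. -/
def invariantTransfer : InfAlg :=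
  (hc.prod (isLocal_slots _) hi).emb
    (averagedTransfer a (finSlotPerm K (column K L)) z HasFixedSlot θ)

theorem star_transfer_mul
    (hT : IsTransfer (finSlotPerm K (column K L)) HasFixedSlot θ) (m : Matrix Y Y ℂ) :
    star (transfer hc hi a z θ) * hc.emb m * transfer hc hi a z θ =
      m z z • nonfreeProj K L := by
  rw [transfer, ← hc.emb_prod_lift_fst (isLocal_slots _) hi, ← map_star, ← map_mul, ← map_mul,
    star_transferMatrix_mul hT, if_pos rfl, map_smul, hc.emb_prod_lift_snd, map_one]
  rfl

theorem star_invariantTransfer_mul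
    (hT : IsTransfer (finSlotPerm K (column K L)) HasFixedSlot θ) (m : Matrix Y Y ℂ) :
    star (invariantTransfer hc hi a z θ) * hc.emb m * invariantTransfer hc hi a z θ =
      ((Fintype.card (Fin K → ZTwo) : ℂ)⁻¹ * ∑ h, m (a h z) (a h z)) • nonfreeProj K L := by
  rw [invariantTransfer, ← hc.emb_prod_lift_fst (isLocal_slots _) hi, ← map_star, ← map_mul,
    ← map_mul, star_averagedTransfer_mul hT, map_smul, hc.emb_prod_lift_snd]
  rfl

theorem star_transfer_mul_self
    (hT : IsTransfer (finSlotPerm K (column K L)) HasFixedSlot θ) :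
    star (transfer hc hi a z θ) * transfer hc hi a z θ = nonfreeProj K L := by
  simpa using star_transfer_mul hc hi (a := a) (z := z) hT 1

theorem star_invariantTransfer_mul_self
    (hT : IsTransfer (finSlotPerm K (column K L)) HasFixedSlot θ) :
    star (invariantTransfer hc hi a z θ) * invariantTransfer hc hi a z θ = nonfreeProj K L := by
  simpa using star_invariantTransfer_mul hc hi (a := a) (z := z) hT 1

theorem nonfreeProj_mul_invariantTransfer
    (hT : IsTransfer (finSlotPerm K (column K L)) HasFixedSlot θ) :
    nonfreeProj K L * invariantTransfer hc hi a z θ = 0 := by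
  have h : nonfreeProj K L = (hc.prod (isLocal_slots _) hi).emb
      ((Coordinate.snd Y _).lift (indicatorMatrix HasFixedSlot)) :=
    (hc.emb_prod_lift_snd _ hi _).symm
  rw [invariantTransfer, h, ← map_mul, indicatorMatrix_mul_averagedTransfer hT, map_zero]

theorem infAction_invariantTransfer
    (hT : IsTransfer (finSlotPerm K (column K L)) HasFixedSlot θ)
    (he : IsEquivariant c (a.comp (truncHom K)))
    (g : ℕ → ZTwo) :
    infAction g (invariantTransfer hc hi a z θ) = invariantTransfer hc hi a z θ := by
  rw [invariantTransfer, (he.prod (isEquivariant_column K L) hi).infAction_emb]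
  exact congrArg _ (averagedTransfer_submatrix hT (truncHom K g))

/-- The complement of the free orbits is Cuntz subequivalent, by an exact relation, to any positive
element that is close to a matrix, compared to a diagonal entry of this matrix. -/
theorem exists_conj_eq_nonfreeProj
    (hi : c.Indep (slots (column K L)))
    (hT : IsTransfer (finSlotPerm K (column K L)) HasFixedSlot θ)
    {x : InfAlg} (hx : IsSelfAdjoint x) {m : Matrix Y Y ℂ}
    {k δ : ℝ} (hδ : ‖x - hc.emb m‖ ≤ δ) (hm : ‖m z z - k‖ ≤ δ) (hk : 2 * δ < k) :
    ∃ v, v * x * star v = nonfreeProj K L := by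
  obtain ⟨v, hv, -⟩ := exists_conj_eq_star_mul_self hx (isStarProjection_nonfreeProj K L)
    (star_transfer_mul_self hc hi (a := 1) (z := z) hT) (star_transfer_mul hc hi hT m) hδ hm hk
  exact ⟨v, hv⟩

/-- The invariant version of `exists_conj_eq_nonfreeProj`. -/
theorem exists_invariant_conj_eq_nonfreeProj
    (hi : c.Indep (slots (column K L)))
    (hT : IsTransfer (finSlotPerm K (column K L)) HasFixedSlot θ)
    (he : IsEquivariant c (a.comp (truncHom K)))
    {y : InfAlg} (hy : IsSelfAdjoint y) (hinv : ∀ g, infAction g y = y) {m : Matrix Y Y ℂ}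
    {k δ : ℝ} (hδ : ‖y - hc.emb m‖ ≤ δ) (hm : ∀ h, ‖m (a h z) (a h z) - k‖ ≤ δ)
    (hk : 2 * δ < k) :
    ∃ v, v * y * star v = nonfreeProj K L ∧ ∀ g, infAction g v = v := by
  have hcard : (Fintype.card (Fin K → ZTwo) : ℝ) ≠ 0 := by exact_mod_cast Fintype.card_ne_zero
  have hμ : ‖(Fintype.card (Fin K → ZTwo) : ℂ)⁻¹ * ∑ h, m (a h z) (a h z) - k‖ ≤ δ := by
    have e : (Fintype.card (Fin K → ZTwo) : ℂ)⁻¹ * ∑ h, m (a h z) (a h z) - k =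
        (Fintype.card (Fin K → ZTwo) : ℂ)⁻¹ * ∑ h, (m (a h z) (a h z) - k) := by
      rw [Finset.sum_sub_distrib, Finset.sum_const, Finset.card_univ, nsmul_eq_mul, mul_sub,
        inv_mul_cancel_left₀ (by exact_mod_cast hcard)]
    rw [e, norm_mul, norm_inv, Complex.norm_natCast, inv_mul_le_iff₀ (by positivity)]
    refine (norm_sum_le _ _).trans ((Finset.sum_le_sum fun h _ => hm h).trans_eq ?_)
    rw [Finset.sum_const, Finset.card_univ, nsmul_eq_mul]
  obtain ⟨v, hv, hvinv⟩ := exists_conj_eq_star_mul_self hy (isStarProjection_nonfreeProj K L)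
    (star_invariantTransfer_mul_self hc hi (a := a) (z := z) hT)
    (star_invariantTransfer_mul hc hi hT m) hδ hμ hk
  exact ⟨v, hv, fun g => hvinv (infAction g) (hinv g)
    (infAction_invariantTransfer hc hi hT he g)⟩

end

/-! ### The Rokhlin maps -/

/-- Evaluation of `f ∈ C(G)` on the free orbits in `column K L`: the basis vectors whose blocks are
given by `h ∈ ∏_{n < K} ℤ/2` contribute the value of `f` at `h`. -/
def evalBlocks (K L : ℕ) : C(ℕ → ZTwo, ℂ) →⋆ₙₐ[ℂ] (SlotValues (column K L) → ℂ) where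
  toFun f t := if HasFixedSlot t then 0 else f (extendHom K (columnBlocks t))
  map_smul' r f := by ext t; by_cases h : HasFixedSlot t <;> simp [h]
  map_zero' := by ext t; simp
  map_add' f g := by ext t; by_cases h : HasFixedSlot t <;> simp [h]
  map_mul' f g := by ext t; by_cases h : HasFixedSlot t <;> simp [h]
  map_star' f := by ext t; by_cases h : HasFixedSlot t <;> simp [h]

theorem evalBlocks_apply (K L : ℕ) (f : C(ℕ → ZTwo, ℂ)) (t : SlotValues (column K L)) :
    evalBlocks K L f t = if HasFixedSlot t then 0 else f (extendHom K (columnBlocks t)) := rfl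

/-- The homomorphism `C(G) → p A p` given by the blocks of the basis vectors in `column K L`. -/
def rokhlinHom (K L : ℕ) : C(ℕ → ZTwo, ℂ) →⋆ₙₐ[ℂ] InfAlg :=
  ((isLocal_slots (column K L)).diagEmb : _ →⋆ₙₐ[ℂ] InfAlg).comp (evalBlocks K L)

theorem rokhlinHom_apply (K L : ℕ) (f : C(ℕ → ZTwo, ℂ)) :
    rokhlinHom K L f = (isLocal_slots (column K L)).diagEmb (evalBlocks K L f) := rfl

theorem rokhlinHom_one (K L : ℕ) : rokhlinHom K L 1 = 1 - nonfreeProj K L := by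
  rw [nonfreeProj_eq_diagEmb, ← map_one (isLocal_slots (column K L)).diagEmb, ← map_sub,
    rokhlinHom_apply]
  congr 1
  ext t
  by_cases ht : HasFixedSlot t <;> simp [evalBlocks_apply, ht]

theorem infAction_nonfreeProj (K L : ℕ) (g : ℕ → ZTwo) :
    infAction g (nonfreeProj K L) = nonfreeProj K L := by
  rw [nonfreeProj_eq_diagEmb, (isEquivariant_slots _).infAction_diagEmb]
  simp only [hasFixedSlot_slotPerm]

theorem norm_rokhlinHom_equivariant_le {K L : ℕ} {f : C(ℕ → ZTwo, ℂ)} {δ : ℝ} (hδ : 0 ≤ δ)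
    (hf : ∀ g, ‖f g - f (extendHom K (truncHom K g))‖ ≤ δ) (g : ℕ → ZTwo) :
    ‖rokhlinHom K L (leftTranslation _ g f) - infAction g (rokhlinHom K L f)‖ ≤ δ := by
  rw [rokhlinHom_apply, rokhlinHom_apply, (isEquivariant_slots _).infAction_diagEmb, ← map_sub]
  refine (NonUnitalStarAlgHom.norm_apply_le _ _).trans ((pi_norm_le_iff_of_nonneg hδ).2 fun t => ?_)
  rw [Pi.sub_apply, evalBlocks_apply, evalBlocks_apply]
  simp only [hasFixedSlot_slotPerm]
  by_cases ht : HasFixedSlot t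
  · simp [ht, hδ]
  · rw [if_neg ht, if_neg ht, columnBlocks_slotPerm _ ht]
    have h := hf (g⁻¹ * extendHom K (columnBlocks t))
    rw [map_mul (truncHom K), truncHom_extendHom] at h
    exact h

theorem commute_boxEmb_columnEmb {K L : ℕ} (hL : K ≤ L)
    (m : Matrix (SlotValues (box K)) (SlotValues (box K)) ℂ)
    (n : Matrix (SlotValues (column K L)) (SlotValues (column K L)) ℂ) :
    Commute (boxEmb K m) (columnEmb K L n) :=
  (isLocal_slots _).commute_emb (isLocal_slots _) (slots_indep (disjoint_box_column hL)) m n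

/-- A basis vector in the column with a free orbit. -/
theorem exists_not_hasFixedSlot (K L : ℕ) : ∃ t : SlotValues (column K L), ¬ HasFixedSlot t := by
  have hpos (k : ℕ) : 0 < blockSize (k + 1) := by
    have h1 := two_mul_blockSize_add_one (k + 1)
    have h2 := Nat.one_le_pow k 3 (by norm_num)
    rw [pow_succ] at h1
    omega
  exact ⟨_, not_hasFixedSlot_firstBlock fun s => ⟨0, hpos _⟩⟩

open scoped Matrix.Norms.L2Operator in
/-- Multiplication with a rank one projection in the column does not change the norms of elements
of the matrix algebra of the box, because it is an injective homomorphism on that algebra. -/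
theorem norm_boxEmb_mul_columnEmb_single {K L : ℕ} (hL : K ≤ L) (t : SlotValues (column K L))
    (m : Matrix (SlotValues (box K)) (SlotValues (box K)) ℂ) :
    ‖boxEmb K m * (isLocal_slots (column K L)).diagEmb (Pi.single t 1)‖ = ‖boxEmb K m‖ := by
  have hproj : IsStarProjection ((isLocal_slots (column K L)).diagEmb (Pi.single t 1)) :=
    (isLocal_slots _).isStarProjection_diagEmb fun i => by by_cases h : i = t <;> simp [h]
  set e := (isLocal_slots (column K L)).diagEmb (Pi.single t 1) with he
  have hcomm (m) : Commute (boxEmb K m) e := commute_boxEmb_columnEmb hL m _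
  have hee : e * e = e := hproj.isIdempotentElem
  have hes : star e = e := hproj.isSelfAdjoint
  let ψ : Matrix (SlotValues (box K)) (SlotValues (box K)) ℂ →⋆ₙₐ[ℂ] InfAlg :=
    { toFun := fun m => boxEmb K m * e
      map_smul' := fun r m => by simp
      map_zero' := by simp
      map_add' := fun m n => by rw [map_add, add_mul]
      map_mul' := fun m n => by
        rw [map_mul, mul_assoc, mul_assoc, ← mul_assoc e, ← (hcomm n).eq, mul_assoc, hee]
      map_star' := fun m => by rw [star_mul, hes, map_star, ← map_star, (hcomm _).eq] }
  have hψ : Function.Injective ψ := by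
    refine (injective_iff_map_eq_zero ψ).2 fun m hm => ?_
    have hd := slots_indep (disjoint_box_column hL)
    have h1 : ((isLocal_slots (box K)).prod (isLocal_slots (column K L)) hd).emb
        ((Coordinate.fst _ _).lift m *
          (Coordinate.snd _ _).lift (Matrix.diagonal (Pi.single t 1))) = 0 := by
      rw [map_mul, (isLocal_slots (box K)).emb_prod_lift_fst (isLocal_slots (column K L)),
        (isLocal_slots (box K)).emb_prod_lift_snd (isLocal_slots (column K L))]
      exact hm
    have h2 := (injective_iff_map_eq_zero _).1 (IsLocal.emb_injective _) _ h1
    ext i j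
    have h3 := congrFun (congrFun h2 (i, t)) (j, t)
    rw [Coordinate.fst_lift_mul_snd_lift] at h3
    simpa using h3
  have h1 : ‖ψ m‖ = ‖m‖ :=
    (NonUnitalStarAlgHom.isometry ψ hψ).norm_map_of_map_zero (map_zero ψ) m
  have h2 : ‖boxEmb K m‖ = ‖m‖ :=
    (NonUnitalStarAlgHom.isometry (boxEmb K) (isLocal_slots _).emb_injective).norm_map_of_map_zero
      (map_zero _) m
  rw [h2, ← h1]
  rfl

theorem norm_boxEmb_le_norm_compress {K L : ℕ} (hL : K ≤ L)
    (m : Matrix (SlotValues (box K)) (SlotValues (box K)) ℂ) :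
    ‖boxEmb K m‖ ≤ ‖(1 - nonfreeProj K L) * boxEmb K m * (1 - nonfreeProj K L)‖ := by
  obtain ⟨t, ht⟩ := exists_not_hasFixedSlot K L
  have hproj : IsStarProjection ((isLocal_slots (column K L)).diagEmb (Pi.single t 1)) :=
    (isLocal_slots _).isStarProjection_diagEmb fun i => by by_cases h : i = t <;> simp [h]
  set e := (isLocal_slots (column K L)).diagEmb (Pi.single t 1) with he
  have hzero : (Pi.single t 1 * fun t => if HasFixedSlot t then 1 else 0 :
      SlotValues (column K L) → ℂ) = 0 := by
    ext i
    by_cases h : i = t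
    · subst h
      simp only [Pi.mul_apply, if_neg ht, mul_zero, Pi.zero_apply]
    · simp [h]
  have heq : e * nonfreeProj K L = 0 := by
    rw [he, nonfreeProj_eq_diagEmb, ← map_mul, hzero, map_zero]
  have hqe : nonfreeProj K L * e = 0 := by
    rw [he, nonfreeProj_eq_diagEmb, ← map_mul, mul_comm, hzero, map_zero]
  have hcomm : Commute (boxEmb K m) e := commute_boxEmb_columnEmb hL m _
  have key : e * ((1 - nonfreeProj K L) * boxEmb K m * (1 - nonfreeProj K L)) * e =
      boxEmb K m * e := by
    have h1 : e * (1 - nonfreeProj K L) = e := by rw [mul_sub, mul_one, heq, sub_zero]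
    have h2 : (1 - nonfreeProj K L) * e = e := by rw [sub_mul, one_mul, hqe, sub_zero]
    rw [mul_assoc, mul_assoc, h2, ← mul_assoc, ← mul_assoc, h1,
      ← hcomm.eq, mul_assoc, hproj.isIdempotentElem.eq]
  rw [← norm_boxEmb_mul_columnEmb_single hL t m, ← he, ← key]
  calc _ ≤ ‖e‖ * ‖(1 - nonfreeProj K L) * boxEmb K m * (1 - nonfreeProj K L)‖ * ‖e‖ :=
        norm_mul₃_le
    _ ≤ 1 * ‖(1 - nonfreeProj K L) * boxEmb K m * (1 - nonfreeProj K L)‖ * 1 := by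
        gcongr <;> exact hproj.norm_le
    _ = _ := by ring

/-! ### Comparison and simplicity -/

/-- Diagonal coefficients of an element of `A` and of the matrices close to it. -/
theorem norm_apply_sub_diagCoeff_le {K : ℕ} {x : InfAlg}
    {m : Matrix (SlotValues (box K)) (SlotValues (box K)) ℂ} {δ : ℝ} (h : ‖x - boxEmb K m‖ ≤ δ)
    (z : InfIndex) :
    ‖m ((slots (box K)).get z) ((slots (box K)).get z) - diagCoeff z x‖ ≤ δ := by
  rw [← (isLocal_slots (box K)).diagCoeff_emb m z, ← diagCoeff_sub]
  refine (norm_diagCoeff_le _ _).trans ?_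
  rw [norm_sub_rev]
  exact h

/-- The comparison with `x` is exact in all large boxes, because the diagonal entries of a matrix
close to `x` include one that is nearly a positive diagonal coefficient of `x`. -/
theorem eventually_exists_conj_eq_nonfreeProj {x : InfAlg} (hx : 0 ≤ x) (hx0 : x ≠ 0) :
    ∀ᶠ K in Filter.atTop, ∀ L ≥ K,
      ∀ θ : SlotValues (box K) × SlotValues (column K L) → SlotValues (column K L),
      IsTransfer (finSlotPerm K (column K L)) HasFixedSlot θ →
      ∃ v, v * x * star v = nonfreeProj K L := by
  obtain ⟨z, k, hk, hz⟩ := exists_diagCoeff_pos hx hx0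
  obtain ⟨K₀, hK₀⟩ := exists_norm_sub_boxEmb_lt x (by positivity : 0 < k / 3)
  filter_upwards [Filter.eventually_ge_atTop K₀] with K hK L hL θ hθ
  obtain ⟨m, hm⟩ := hK₀ K hK
  have h := norm_apply_sub_diagCoeff_le hm.le z
  rw [hz] at h
  exact exists_conj_eq_nonfreeProj (isLocal_slots (box K)) (slots_indep (disjoint_box_column hL)) hθ
    (IsSelfAdjoint.of_nonneg hx) hm.le h (by linarith)

/-- The invariant version of `eventually_exists_conj_eq_nonfreeProj`. -/
theorem eventually_exists_invariant_conj_eq_nonfreeProj {y : InfAlg} (hy : 0 ≤ y) (hy0 : y ≠ 0)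
    (hinv : ∀ g, infAction g y = y) :
    ∀ᶠ K in Filter.atTop, ∀ L ≥ K,
      ∀ θ : SlotValues (box K) × SlotValues (column K L) → SlotValues (column K L),
      IsTransfer (finSlotPerm K (column K L)) HasFixedSlot θ →
      ∃ v, v * y * star v = nonfreeProj K L ∧ ∀ g, infAction g v = v := by
  obtain ⟨z, k, hk, hz⟩ := exists_diagCoeff_pos hy hy0
  obtain ⟨K₀, hK₀⟩ := exists_norm_sub_boxEmb_lt y (by positivity : 0 < k / 3)
  filter_upwards [Filter.eventually_ge_atTop K₀] with K hK L hL θ hθ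
  obtain ⟨m, hm⟩ := hK₀ K hK
  refine exists_invariant_conj_eq_nonfreeProj (isLocal_slots (box K)) (k := k) (δ := k / 3)
    (slots_indep (disjoint_box_column hL)) hθ
    (isEquivariant_slots_truncHom fun s hs => (mem_box.1 hs).1)
    (IsSelfAdjoint.of_nonneg hy) hinv hm.le
    (z := (slots (box K)).get z) (fun h => ?_) (by linarith)
  have h1 := norm_apply_sub_diagCoeff_le hm.le (infPerm (extendHom K h) z)
  rw [diagCoeff_infPerm (hinv _), hz] at h1
  exact h1

/-- A coordinate with one value contributes nothing. -/
theorem exists_emb_unit_prod_eq {X : Type} [DecidableEq X] [Fintype X] {d : Coordinate InfIndex X}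
    (hd : IsLocal d) (h : (Coordinate.unit InfIndex).Indep d)
    (m : Matrix (Unit × X) (Unit × X) ℂ) :
    ∃ n, (isLocal_unit.prod hd h).emb m = hd.emb n := by
  refine ⟨m.submatrix (Prod.mk ()) (Prod.mk ()), ?_⟩
  rw [← isLocal_unit.emb_prod_lift_snd hd h]
  congr 1
  ext e e'
  simp [Coordinate.lift]

instance : Nontrivial InfAlg := by
  by_contra h
  rw [not_nontrivial_iff_subsingleton] at h
  exact not_finiteDimensional_infAlg inferInstance

/-- Every nonzero ideal contains a complement of the free orbits in some column, and thus a minimal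
projection of a full matrix algebra. -/
theorem isSimpleRing_infAlg : IsSimpleRing InfAlg := by
  refine IsSimpleRing.of_eq_bot_or_eq_top fun I => ?_
  by_contra! hI
  obtain ⟨x, hxI, hx0⟩ : ∃ x ∈ I, x ≠ 0 := by
    by_contra! h
    exact hI.1 (eq_bot_iff.2 fun x hx => by rw [h x hx]; exact zero_mem _)
  obtain ⟨K, hK, hK1⟩ := ((eventually_exists_conj_eq_nonfreeProj (star_mul_self_nonneg x)
    (by rwa [Ne, CStarRing.star_mul_self_eq_zero_iff])).and (Filter.eventually_ge_atTop 1)).exists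
  obtain ⟨L, hL, θ, hθ⟩ := exists_isTransfer K (SlotValues (box K))
  obtain ⟨v, hv⟩ := hK L hL θ hθ
  have hq : nonfreeProj K L ∈ I := by
    rw [← hv]
    exact I.mul_mem_right _ _ (I.mul_mem_left _ _ (I.mul_mem_left _ _ hxI))
  let t₀ : SlotValues (column K L) := fun _ => .inr (.inr ())
  have ht₀ : HasFixedSlot t₀ := ⟨⟨(0, L), by simp; omega⟩, rfl⟩
  have h1 : (1 : InfAlg) = ∑ t, columnEmb K L (Matrix.single t t₀ 1) * nonfreeProj K L *
      columnEmb K L (Matrix.single t₀ t 1) := by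
    have h2 (t) : columnEmb K L (Matrix.single t t₀ 1) * nonfreeProj K L *
        columnEmb K L (Matrix.single t₀ t 1) = columnEmb K L (Matrix.single t t 1) := by
      rw [nonfreeProj, ← map_mul, ← map_mul, Matrix.single_mul_mul_single, indicatorMatrix,
        Matrix.diagonal_apply_eq, if_pos ht₀, one_mul, one_mul]
    simp only [h2]
    rw [← map_sum, ← map_one (columnEmb K L)]
    congr 1
    exact Matrix.sum_single_one.symm
  refine hI.2 (eq_top_iff.2 fun a _ => ?_)
  rw [← mul_one a, h1]
  exact I.mul_mem_left _ _ (sum_mem fun t _ => I.mul_mem_right _ _ (I.mul_mem_left _ _ hq))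

/-! ### The tracial Rokhlin properties -/

/-- The complement of the free orbits is equivalent to a subprojection of its complement, by a
partial isometry that is invariant and acts in the column only. -/
theorem exists_invariant_partialIsometry {K L : ℕ} {Y : Type} [Nonempty Y]
    {θ : Y × SlotValues (column K L) → SlotValues (column K L)}
    (hθ : IsTransfer (finSlotPerm K (column K L)) HasFixedSlot θ) :
    ∃ n, (∀ g, infAction g (columnEmb K L n) = columnEmb K L n) ∧
      star (columnEmb K L n) * columnEmb K L n = nonfreeProj K L ∧
      nonfreeProj K L * columnEmb K L n = 0 := by
  have hi : (Coordinate.unit InfIndex).Indep (slots (column K L)) :=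
    ⟨fun _ _ => rfl, fun _ _ => rfl, fun _ _ _ => rfl⟩
  have i₀ : Y := Classical.arbitrary Y
  have hθ' := hθ.comp_left (f := fun _ : Unit => i₀) fun _ _ _ => rfl
  obtain ⟨n, hn⟩ := exists_emb_unit_prod_eq (isLocal_slots (column K L)) hi
    (averagedTransfer 1 (finSlotPerm K (column K L)) () HasFixedSlot _)
  have hn' : columnEmb K L n = invariantTransfer isLocal_unit hi 1 () _ := hn.symm
  refine ⟨n, fun g => ?_, ?_, ?_⟩
  · rw [hn']
    exact infAction_invariantTransfer isLocal_unit hi hθ' isEquivariant_unit g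
  · rw [hn']
    exact star_invariantTransfer_mul_self isLocal_unit hi hθ'
  · rw [hn']
    exact nonfreeProj_mul_invariantTransfer isLocal_unit hi hθ'

theorem mul_star_self_le_of_mul_eq {A : Type*} [CStarAlgebra A] [PartialOrder A]
    [StarOrderedRing A] {p s : A} (hp : IsStarProjection p) (hps : p * s = s)
    (hs : IsStarProjection (star s * s)) : s * star s ≤ p := by
  have hsp : star s * p = star s := by
    rw [← hp.isSelfAdjoint.star_eq, ← star_mul, hps]
  have hsss : s * star s * (s * star s) = s * star s := by
    rw [← mul_assoc, mul_assoc s, mul_eq_self_of_star_mul_self hs rfl]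
  -- the difference is a projection
  have h : star (p - s * star s) * (p - s * star s) = p - s * star s := by
    rw [star_sub, star_mul, star_star, hp.isSelfAdjoint.star_eq, sub_mul, mul_sub, mul_sub,
      hp.isIdempotentElem.eq, ← mul_assoc p, hps, mul_assoc s (star s) p, hsp, hsss]
    abel
  rw [← sub_nonneg, ← h]
  exact star_mul_self_nonneg _

theorem mul_star_self_le_one_sub {A : Type*} [CStarAlgebra A] [PartialOrder A] [StarOrderedRing A]
    {q s : A} (hq : IsStarProjection q) (hs : star s * s = q) (hqs : q * s = 0) :
    s * star s ≤ 1 - q :=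
  mul_star_self_le_of_mul_eq hq.one_sub (by rw [sub_mul, one_mul, hqs, sub_zero]) (hs ▸ hq)

theorem norm_sub_le_norm_compress_of_close {A : Type*} [CStarAlgebra A] {p x b : A} {η : ℝ}
    (hp : IsStarProjection p) (hxb : ‖x - b‖ ≤ η) (hb : ‖b‖ ≤ ‖p * b * p‖) :
    ‖x‖ - 2 * η ≤ ‖p * x * p‖ := by
  have hp1 := hp.norm_le
  have h2 : ‖p * (x - b) * p‖ ≤ η := by
    calc _ ≤ ‖p‖ * ‖x - b‖ * ‖p‖ := norm_mul₃_le
      _ ≤ 1 * ‖x - b‖ * 1 := by gcongr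
      _ ≤ η := by rwa [one_mul, mul_one]
  have h3 : p * b * p = p * x * p - p * (x - b) * p := by noncomm_ring
  have h4 := norm_sub_le (p * x * p) (p * (x - b) * p)
  rw [← h3] at h4
  have h5 := norm_sub_norm_le x b
  linarith

theorem norm_le_one_of_star_mul_self {A : Type*} [CStarAlgebra A] {q s : A}
    (hq : IsStarProjection q) (hs : star s * s = q) : ‖s‖ ≤ 1 := by
  have h1 : ‖s‖ * ‖s‖ ≤ 1 := by
    rw [← CStarRing.norm_star_mul_self, hs]; exact hq.norm_le
  nlinarith [norm_nonneg s]

/-- Elements of the column almost commute with elements close to the box. -/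
theorem norm_columnEmb_commutator_le {K L : ℕ} (hL : K ≤ L) {a : InfAlg}
    {m : Matrix (SlotValues (box K)) (SlotValues (box K)) ℂ} {η r : ℝ}
    (hm : ‖a - boxEmb K m‖ ≤ η)
    {n : Matrix (SlotValues (column K L)) (SlotValues (column K L)) ℂ}
    (hn : ‖columnEmb K L n‖ ≤ r) :
    ‖columnEmb K L n * a - a * columnEmb K L n‖ ≤ 2 * (r * η) := by
  have hr0 : 0 ≤ r := (norm_nonneg _).trans hn
  have hη0 : 0 ≤ η := (norm_nonneg _).trans hm
  have e : columnEmb K L n * a - a * columnEmb K L n =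
      columnEmb K L n * (a - boxEmb K m) - (a - boxEmb K m) * columnEmb K L n := by
    rw [mul_sub, sub_mul, (commute_boxEmb_columnEmb hL m n).eq]
    abel
  rw [e]
  calc _ ≤ ‖columnEmb K L n * (a - boxEmb K m)‖ + ‖(a - boxEmb K m) * columnEmb K L n‖ :=
        norm_sub_le _ _
    _ ≤ ‖columnEmb K L n‖ * ‖a - boxEmb K m‖ + ‖a - boxEmb K m‖ * ‖columnEmb K L n‖ :=
        add_le_add (norm_mul_le _ _) (norm_mul_le _ _)
    _ ≤ r * η + η * r := by gcongr
    _ = 2 * (r * η) := by ring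

theorem norm_sub_le_norm_compress {K L : ℕ} (hL : K ≤ L) {x : InfAlg}
    {m : Matrix (SlotValues (box K)) (SlotValues (box K)) ℂ} {η : ℝ}
    (hm : ‖x - boxEmb K m‖ ≤ η) :
    ‖x‖ - 2 * η ≤ ‖(1 - nonfreeProj K L) * x * (1 - nonfreeProj K L)‖ :=
  norm_sub_le_norm_compress_of_close (isStarProjection_nonfreeProj K L).one_sub hm
    (norm_boxEmb_le_norm_compress hL m)

/-- The homomorphism `rokhlinHom K L` as a completely positive map. -/
def rokhlinMap (K L : ℕ) : C(ℕ → ZTwo, ℂ) →CP InfAlg :=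
  CompletelyPositiveMapClass.toCompletelyPositiveLinearMap (rokhlinHom K L)

theorem rokhlinMap_apply (K L : ℕ) (f : C(ℕ → ZTwo, ℂ)) :
    rokhlinMap K L f = rokhlinHom K L f := rfl

theorem norm_rokhlinMap_le (K L : ℕ) (f : C(ℕ → ZTwo, ℂ)) : ‖rokhlinMap K L f‖ ≤ ‖f‖ :=
  NonUnitalStarAlgHom.norm_apply_le (rokhlinHom K L) f

theorem isUnitalIntoCorner_rokhlinMap (K L : ℕ) :
    IsUnitalIntoCorner (rokhlinMap K L) (1 - nonfreeProj K L) := by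
  refine ⟨rokhlinHom_one K L, fun f => ?_⟩
  rw [rokhlinMap_apply, ← rokhlinHom_one, ← map_mul, ← map_mul, one_mul, mul_one]

theorem isApproxEquivariantCentralMultiplicative_rokhlinMap {K L : ℕ} (hL : K ≤ L)
    {F : Set InfAlg} {S : Set C(ℕ → ZTwo, ℂ)} {ε M η : ℝ} (hε : 0 < ε) (hM : 2 * (M * η) < ε)
    (hF : ∀ a ∈ F, ∃ m, ‖a - boxEmb K m‖ < η) (hSM : ∀ f ∈ S, ‖f‖ ≤ M)
    (hS : ∀ f ∈ S, ∀ g, ‖f g - f (extendHom K (truncHom K g))‖ < ε / 2) :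
    IsApproxEquivariantCentralMultiplicative (leftTranslation _) infAction S F ε
      (rokhlinMap K L) where
  mul f _ g _ := by
    rwa [rokhlinMap_apply, rokhlinMap_apply, rokhlinMap_apply, map_mul, sub_self, norm_zero]
  central f hf a ha := by
    obtain ⟨m, hm⟩ := hF a ha
    exact (norm_columnEmb_commutator_le hL hm.le
      ((norm_rokhlinMap_le K L f).trans (hSM f hf))).trans_lt hM
  equivariant f hf := by
    refine (iSup_le fun g => ?_ : _ ≤ ENNReal.ofReal (ε / 2)).trans_lt
      ((ENNReal.ofReal_lt_ofReal_iff hε).2 (by linarith))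
    rw [← ofReal_norm]
    exact ENNReal.ofReal_le_ofReal
      (norm_rokhlinHom_equivariant_le (by linarith) (fun g => (hS f hf g).le) g)

theorem cuntzLE_of_conj_eq {D : Type*} [Mul D] [Star D] [TopologicalSpace D] {a b v : D}
    (h : v * b * star v = a) : CuntzLE a b :=
  ⟨fun _ => v, by simpa only [h] using tendsto_const_nhds⟩

/-- Both sets of conditions hold for a common projection and a common map. -/
theorem exists_trpcConditions_and_strongModifiedTRPConditions (F : Finset InfAlg)
    (S : Finset C(ℕ → ZTwo, ℂ)) {ε : ℝ} (hε : 0 < ε) {x : InfAlg} (hx : 0 ≤ x) (hx1 : ‖x‖ = 1)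
    {y : fixedPoints infAction} (hy : 0 ≤ (y : InfAlg)) (hy0 : y ≠ 0) :
    ∃ (p : fixedPoints infAction) (φ : C(ℕ → ZTwo, ℂ) →CP InfAlg),
      TRPCConditions infAction F S ε x y p φ ∧
      ∃ s : fixedPoints infAction, StrongModifiedTRPConditions infAction F S ε x p s φ := by
  have hx0 : x ≠ 0 := by rintro rfl; simp at hx1
  have hy0' : (y : InfAlg) ≠ 0 := fun h => hy0 (Subtype.ext h)
  -- `M` bounds the norms of the functions in `S` and of the partial isometry
  obtain ⟨M, hM1, hMS⟩ : ∃ M : ℝ, 1 ≤ M ∧ ∀ f ∈ S, ‖f‖ ≤ M := by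
    have h0 : ∀ f ∈ S, 0 ≤ ‖f‖ := fun f _ => norm_nonneg f
    refine ⟨1 + ∑ f ∈ S, ‖f‖, by linarith [Finset.sum_nonneg h0], fun f hf => ?_⟩
    linarith [Finset.single_le_sum h0 hf]
  obtain ⟨η, hη0, hηM⟩ : ∃ η : ℝ, 0 < η ∧ 4 * (M * η) = ε :=
    ⟨ε / (4 * M), by positivity, by field_simp⟩
  have hηε : 4 * η ≤ ε := by nlinarith
  have happ (a : InfAlg) : ∀ᶠ K in Filter.atTop, ∃ m, ‖a - boxEmb K m‖ < η :=
    Filter.eventually_atTop.2 (exists_norm_sub_boxEmb_lt a hη0)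
  have hfun (f : C(ℕ → ZTwo, ℂ)) :
      ∀ᶠ K in Filter.atTop, ∀ g, ‖f g - f (extendHom K (truncHom K g))‖ < ε / 2 :=
    Filter.eventually_atTop.2 (exists_norm_sub_extendHom_lt f (half_pos hε))
  obtain ⟨K, hKF, hKS, ⟨m, hm⟩, hKv, hKw⟩ :=
    (((Filter.eventually_all_finset F).2 fun a _ => happ a).and
    (((Filter.eventually_all_finset S).2 fun f _ => hfun f).and ((happ x).and
    ((eventually_exists_conj_eq_nonfreeProj hx hx0).and
    (eventually_exists_invariant_conj_eq_nonfreeProj hy hy0' y.2))))).exists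
  obtain ⟨L, hL, θ, hθ⟩ := exists_isTransfer K (SlotValues (box K))
  obtain ⟨v, hv⟩ := hKv L hL θ hθ
  obtain ⟨w, hw, hwinv⟩ := hKw L hL θ hθ
  have : Nonempty (SlotValues (box K)) := ⟨fun _ => .inr (.inr ())⟩
  obtain ⟨n, hninv, hnn, hqn⟩ := exists_invariant_partialIsometry hθ
  have hqproj := isStarProjection_nonfreeProj K L
  have hn1 := norm_le_one_of_star_mul_self hqproj hnn
  have hnq := mul_eq_self_of_star_mul_self hqproj hnn
  have hnle := mul_star_self_le_one_sub hqproj hnn hqn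
  have hcompress := norm_sub_le_norm_compress hL hm.le
  rw [hx1] at hcompress
  have hcorner := isUnitalIntoCorner_rokhlinMap K L
  have happrox := isApproxEquivariantCentralMultiplicative_rokhlinMap hL
    (F := (F : Set InfAlg)) (S := (S : Set C(ℕ → ZTwo, ℂ))) hε (by linarith) hKF hMS hKS
  have hpproj := hqproj.one_sub
  let p : fixedPoints infAction :=
    ⟨1 - nonfreeProj K L, fun g => by rw [map_sub, map_one, infAction_nonfreeProj]⟩
  let s : fixedPoints infAction := ⟨columnEmb K L n, hninv⟩
  have hp : IsStarProjection p :=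
    ⟨Subtype.ext hpproj.isIdempotentElem, Subtype.ext hpproj.isSelfAdjoint⟩
  have hcompl : 1 - (p : InfAlg) = nonfreeProj K L := sub_sub_cancel 1 _
  have hss : star s * s = 1 - p := Subtype.ext (hnn.trans hcompl.symm)
  have hps : p * s = s := Subtype.ext <| by
    change (1 - nonfreeProj K L) * columnEmb K L n = columnEmb K L n
    rw [sub_mul, one_mul, hqn, sub_zero]
  have hle : CuntzLE (1 - (p : InfAlg)) x := cuntzLE_of_conj_eq (hv.trans hcompl.symm)
  refine ⟨p, rokhlinMap K L, ⟨⟨hp, hcorner, happrox, hle, ?_, ?_⟩, ?_⟩, s, hp, ?_, hcorner,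
    norm_rokhlinMap_le K L, happrox, hle, hss, hnle, fun a ha => ?_, ?_⟩
  · exact cuntzLE_of_conj_eq (v := ⟨w, hwinv⟩) (Subtype.ext (hw.trans hcompl.symm))
  · refine cuntzLE_of_conj_eq (v := star s) ?_
    rw [star_star, mul_assoc, hps, hss]
  · exact lt_of_lt_of_le (by linarith) hcompress
  · refine Subtype.ext ?_
    change columnEmb K L n * star (columnEmb K L n) * columnEmb K L n = columnEmb K L n
    rw [mul_assoc, hnn, hnq]
  · obtain ⟨m', hm'⟩ := hKF a ha
    exact (norm_columnEmb_commutator_le hL hm'.le hn1).trans_lt (by linarith)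
  · exact lt_of_lt_of_le (by linarith) hcompress

end

theorem mainTheorem2 :
    HasTracialRokhlinPropertyWithComparison infAction ∧
    HasStrongModifiedTracialRokhlinProperty infAction ∧
    ∀ (F : Finset InfAlg) (S : Finset C(ℕ → ZTwo, ℂ)) (ε : ℝ), 0 < ε →
      ∀ x : InfAlg, 0 ≤ x → ‖x‖ = 1 →
      ∀ y : fixedPoints infAction, 0 ≤ (y : InfAlg) → y ≠ 0 →
      ∃ (p : fixedPoints infAction) (φ : C(ℕ → ZTwo, ℂ) →CP InfAlg),
        TRPCConditions infAction F S ε x y p φ ∧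
        ∃ s : fixedPoints infAction, StrongModifiedTRPConditions infAction F S ε x p s φ := by
  refine ⟨⟨not_finiteDimensional_infAlg, isSimpleRing_infAlg, continuous_infAction,
    fun F S ε hε x hx hx1 y hy hy0 => ?_⟩, ⟨not_finiteDimensional_infAlg, isSimpleRing_infAlg,
    separableSpace_infAlg, continuous_infAction, fun F S ε hε x hx hx1 => ?_⟩,
    fun F S ε hε x hx hx1 y hy hy0 =>
      exists_trpcConditions_and_strongModifiedTRPConditions F S hε hx hx1 hy hy0⟩
  · obtain ⟨p, φ, h, -⟩ :=
      exists_trpcConditions_and_strongModifiedTRPConditions F S hε hx hx1 hy hy0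
    exact ⟨p, φ, h⟩
  · obtain ⟨p, φ, -, s, h⟩ := exists_trpcConditions_and_strongModifiedTRPConditions F S hε hx hx1
      (y := 1) zero_le_one fun h => one_ne_zero (congrArg Subtype.val h)
    exact ⟨p, s, φ, h⟩
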